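/- **Setting.** Let $N\ge 1$, let $A\in\mathbb R^{q\times d}$, $B\in\mathbb R^{d'\times q}$, and let $(x^i,y^i)_{1\le i\le N}\in(\mathbb R^d\times\mathbb R^{d'})^N$ be data with pairwise distinct inputs and data separation $\delta=\min_{i\ne j}\|x^i-x^j\|$ (when $N=1$, set $\delta^{-1}=0$). Let $V$ be a reproducing kernel Hilbert space of vector fields $\mathbb R^q\to\mathbb R^q$ with (matrix-valued) kernel $K$. For $v\in L^2([0,1],V)$ and $x\in\mathbb R^d$ put $F(v,x)=Bz_1$, where $z$ is the absolutely continuous solution of $\dot z_t=v_t(z_t)$ on $[0,1]$, $z_0=Ax$, and let $$L(v)=\frac1{2N}\sum_{i=1}^N\|F(v,x^i)-y^i\|^2 .$$ For a matrix $M$ with $n$ columns, $\sigma_{\min}(M)$ and $\sigma_{\max}(M)$ denote the square roots of the smallest and greatest eigenvalues of the $n\times n$ matrix $M^\top M$. Assume that $\sigma_{\min}(A)>0$ and $\sigma_{\min}(B^\top)>0$. **Assumptions on $V$.** (Strong admissibility.) There is $\kappa>0$ such that every $v\in V$ belongs to $W^{2,\infty}(\mathbb R^q,\mathbb R^q)$,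 i.e. is $C^1$, bounded, with bounded and Lipschitz derivative, and $$\|v\|_\infty+\|Dv\|_\infty+\|D^2v\|_\infty\le\kappa\|v\|_V ,$$ where $Dv$ and $D^2 v$ are measured in operator norm, so that $\|D^2v\|_\infty$ is the best Lipschitz constant of $Dv$. ($N$-universality.) For $(z^i)\in(\mathbb R^q)^N$ let $\mathbb K((z^i)_i)=(K(z^i,z^j))_{1\le i,j\le N}$ be the block kernel matrix. Then $$\Lambda:=\sup_{(z^i)\in(\mathbb R^q)^N}\lambda_{\max}(\mathbb K((z^i)_i))<\infty,\qquad \lambda(s):=\inf_{\substack{(z^i)\in(\mathbb R^q)^N\\ \|z^i-z^j\|\ge s^{-1}\ (i\ne j)}}\lambda_{\min}(\mathbb K((z^i)_i))>0\quad\text{for every } s>0 .$$ (When $N=1$ the separation constraint is void and $\lambda$ is constant.) **Theorem.** Let $v^0\in L^2([0,1],V)$ with $\|v^0\|_{L^2}=R_0$, and assume that there is a radius $R\ge0$ with $$\frac{\sqrt8\,\sigma_{\max}(B^\top)\sqrt{N\Lambda L(v^0)}\;e^{3\kappa(R+R_0)}}{\sigma_{\min}(B^\top)^2\,\lambda\big(\sigma_{\min}(A)^{-1}\delta^{-1}e^{\kappa(R+R_0)}\big)}\le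 R .$$ Put $$\mu:=\frac1N\,\sigma_{\min}(B^\top)^2\,\lambda\big(\sigma_{\min}(A)^{-1}\delta^{-1}e^{\kappa(R+R_0)}\big)\,e^{-2\kappa(R+R_0)} .$$ Then $\mu>0$, $L$ is differentiable on $L^2([0,1],V)$, and there is $\eta_0>0$ such that for every step size $0<\eta\le\eta_0$ one has $\eta\mu<1$ and the gradient descent iterates $v^{k+1}=v^k-\eta\nabla L(v^k)$ started at $v^0$ satisfy, for every $k\ge0$, $$L(v^k)\le(1-\eta\mu)^kL(v^0)\qquad\text{and}\qquad\|v^k-v^0\|_{L^2}\le R ,$$ and $v^k$ converges in $L^2([0,1],V)$ to some $v^*$ with $L(v^*)=0$, which is a global minimizer of $L$. -/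

import Mathlib

open MeasureTheory Set Filter Topology
open scoped ENNReal

noncomputable section

/-- `ℝⁿ` with its Euclidean norm. -/
abbrev Euc (n : ℕ) : Type := EuclideanSpace ℝ (Fin n)

/-! ### Singular values and extreme eigenvalues -/

/-- The greatest singular value of a matrix with `n` columns. -/
def sigmaMax {m n : ℕ} (M : Matrix (Fin m) (Fin n) ℝ) : ℝ :=
  (Matrix.toEuclideanLin M).singularValues 0

/-- The smallest singular value of a matrix `M` with `n` columns: the `n`-th one in decreasing
order, that is, the square root of the least eigenvalue of `Mᵀ * M` (the best constant `c` with
`c * ‖x‖ ≤ ‖M x‖`). It is positive exactly when `n ≥ 1` and `M` is injective. -/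
def sigmaMin {m n : ℕ} (M : Matrix (Fin m) (Fin n) ℝ) : ℝ :=
  (Matrix.toEuclideanLin M).singularValues (n - 1)

/-- The smallest eigenvalue of a real symmetric matrix. -/
def lambdaMin {ι : Type*} [Fintype ι] [DecidableEq ι] (M : Matrix ι ι ℝ) : ℝ :=
  sInf (spectrum ℝ M)

/-- The greatest eigenvalue of a real symmetric matrix. -/
def lambdaMax {ι : Type*} [Fintype ι] [DecidableEq ι] (M : Matrix ι ι ℝ) : ℝ :=
  sSup (spectrum ℝ M)

/-! ### Admissibility -/

/-- The norm `‖f‖_∞ + ‖Df‖_∞ + ‖D²f‖_∞` of `W^{2,∞}(ℝ^q, ℝ^q)`, for a `C¹` vector field `f`, with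
values in `[0, ∞]`. The derivatives are measured in operator norm, and the `L^∞` norm of the weak
derivative `D²f` of `Df` is the best Lipschitz constant of `Df`
(the term with `z = z'` is `0 / 0 = 0`). -/
def w2InftyNorm {q : ℕ} (f : Euc q → Euc q) : ℝ≥0∞ :=
  (⨆ z, ‖f z‖ₑ) + (⨆ z, ‖fderiv ℝ f z‖ₑ) +
    ⨆ z, ⨆ z', ‖fderiv ℝ f z - fderiv ℝ f z'‖ₑ / ‖z - z'‖ₑ

/-- Strong admissibility with constant `κ`: the reproducing kernel Hilbert space `V` of vector
fields on `ℝ^q` is embedded in `W^{2,∞}(ℝ^q, ℝ^q)`, the space of `C¹` vector fields that are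
bounded, with bounded and Lipschitz derivative, and the embedding has norm at most `κ`. -/
def IsAdmissible {q : ℕ} (V : Type*) [NormedAddCommGroup V] [InnerProductSpace ℝ V]
    [RKHS ℝ V (Euc q) (Euc q)] (κ : ℝ) : Prop :=
  0 < κ ∧ ∀ v : V, ContDiff ℝ 1 (v : Euc q → Euc q) ∧
    w2InftyNorm (v : Euc q → Euc q) ≤ ENNReal.ofReal (κ * ‖v‖)

/-! ### Universality -/

/-- The block matrix `(K(zⁱ, zʲ))_{i,j}` of the reproducing kernel `K` of `V`. -/
def kernelMatrix {q N : ℕ} (V : Type*) [NormedAddCommGroup V] [InnerProductSpace ℝ V]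
    [CompleteSpace V] [RKHS ℝ V (Euc q) (Euc q)] (z : Fin N → Euc q) :
    Matrix (Fin N × Fin q) (Fin N × Fin q) ℝ :=
  Matrix.of fun a b =>
    (RKHS.kernel V (z a.1) (z b.1) (EuclideanSpace.single b.2 (1 : ℝ))) a.2

/-- `Λ`, the supremum over all families of `N` points of the greatest eigenvalue of the kernel
matrix. -/
def kernelUpper {q : ℕ} (V : Type*) [NormedAddCommGroup V] [InnerProductSpace ℝ V]
    [CompleteSpace V] [RKHS ℝ V (Euc q) (Euc q)] (N : ℕ) : ℝ :=
  ⨆ z : Fin N → Euc q, lambdaMax (kernelMatrix V z)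

/-- The function `λ`: `kernelLower V N s` is the infimum, over the families of `N` points with
pairwise distances at least `s⁻¹`, of the smallest eigenvalue of the kernel matrix. -/
def kernelLower {q : ℕ} (V : Type*) [NormedAddCommGroup V] [InnerProductSpace ℝ V]
    [CompleteSpace V] [RKHS ℝ V (Euc q) (Euc q)] (N : ℕ) (s : ℝ) : ℝ :=
  ⨅ z : {z : Fin N → Euc q // ∀ i j, i ≠ j → s⁻¹ ≤ ‖z i - z j‖}, lambdaMin (kernelMatrix V z.1)

/-- `N`-universality: `Λ < ∞`, and `λ(δ⁻¹) > 0` for every `δ > 0`. -/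
def IsNUniversal {q : ℕ} (V : Type*) [NormedAddCommGroup V] [InnerProductSpace ℝ V]
    [CompleteSpace V] [RKHS ℝ V (Euc q) (Euc q)] (N : ℕ) : Prop :=
  BddAbove (range fun z : Fin N → Euc q => lambdaMax (kernelMatrix V z)) ∧
    ∀ δ : ℝ, 0 < δ → 0 < kernelLower V N δ⁻¹

/-! ### The model, the empirical risk and gradient descent -/

/-- The Hilbert space `L²([0,1], V)` of control parameters. -/
abbrev Control (V : Type*) [NormedAddCommGroup V] : Type _ :=
  Lp V 2 (volume.restrict (Icc (0 : ℝ) 1))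

/-- `z` solves `ż_t = v_t(z_t)` on `[0,1]` with `z_0 = a`, in the sense of absolutely continuous
functions. -/
def IsForwardSolution {q : ℕ} {V : Type*} [NormedAddCommGroup V] [InnerProductSpace ℝ V]
    [RKHS ℝ V (Euc q) (Euc q)] (v : Control V) (a : Euc q) (z : ℝ → Euc q) : Prop :=
  ContinuousOn z (Icc 0 1) ∧
    IntervalIntegrable (fun s => (v s : V) (z s)) volume 0 1 ∧
    ∀ t ∈ Icc (0 : ℝ) 1, z t = a + ∫ s in (0 : ℝ)..t, (v s : V) (z s)

open Classical in
/-- The value at time `1` of the solution of the forward problem that starts at `a` (for an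
admissible `V` this solution exists and is unique on `[0,1]`). -/
def flowEnd {q : ℕ} {V : Type*} [NormedAddCommGroup V] [InnerProductSpace ℝ V]
    [RKHS ℝ V (Euc q) (Euc q)] (v : Control V) (a : Euc q) : Euc q :=
  if h : ∃ z : ℝ → Euc q, IsForwardSolution v a z then h.choose 1 else 0

/-- The output `F(v, x) = B z_1` of the RKHS-FlowResNet, where `z_0 = A x`. -/
def resNet {d d' q : ℕ} {V : Type*} [NormedAddCommGroup V] [InnerProductSpace ℝ V]
    [RKHS ℝ V (Euc q) (Euc q)] (A : Matrix (Fin q) (Fin d) ℝ) (B : Matrix (Fin d') (Fin q) ℝ)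
    (v : Control V) (x : Euc d) : Euc d' :=
  Matrix.toEuclideanLin B (flowEnd v (Matrix.toEuclideanLin A x))

/-- The empirical risk `L(v) = (1 / 2N) ∑ᵢ ‖F(v, xⁱ) - yⁱ‖²`. -/
def risk {d d' q N : ℕ} {V : Type*} [NormedAddCommGroup V] [InnerProductSpace ℝ V]
    [RKHS ℝ V (Euc q) (Euc q)] (A : Matrix (Fin q) (Fin d) ℝ) (B : Matrix (Fin d') (Fin q) ℝ)
    (x : Fin N → Euc d) (y : Fin N → Euc d') (v : Control V) : ℝ :=
  1 / (2 * (N : ℝ)) * ∑ i, ‖resNet A B v (x i) - y i‖ ^ 2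

/-- The data separation `δ = min_{i ≠ j} ‖xⁱ - xʲ‖` (with value `0`, hence `δ⁻¹ = 0`, for a single
data point). -/
def dataSep {d N : ℕ} (x : Fin N → Euc d) : ℝ :=
  ⨅ p : {p : Fin N × Fin N // p.1 ≠ p.2}, ‖x p.1.1 - x p.1.2‖

/-- Gradient descent `v^{k+1} = v^k - η ∇L(v^k)` from `v⁰`. -/
def gradDescent {E : Type*} [NormedAddCommGroup E] [InnerProductSpace ℝ E] [CompleteSpace E]
    (L : E → ℝ) (η : ℝ) (v₀ : E) : ℕ → E
  | 0 => v₀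
  | k + 1 => gradDescent L η v₀ k - η • gradient L (gradDescent L η v₀ k)

end

/-! Put `M = R + R₀`, which bounds `‖v‖` on the ball of radius `R` around `v₀`. The proof
establishes a Polyak–Łojasiewicz inequality on that ball and shows that the descent is too short to
leave it.

By the adjoint method the gradient of the risk at `v` is `t ↦ N⁻¹ ∑ᵢ K(·, zⁱ_t) pⁱ_t`, where `zⁱ`
are the trajectories and `pⁱ` solve the adjoint equation with `pⁱ_1 = Bᵀ(F(v, xⁱ) - yⁱ)`. By the
reproducing property its squared norm at time `t` is `N⁻²` times the quadratic form of the kernel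
matrix at the points `zⁱ_t`, evaluated at `(pⁱ_t)`. Grönwall's inequality keeps trajectories at
distance at least `σ_min(A) δ e^{-κM}`, so universality bounds this form below by `λ ∑ᵢ ‖pⁱ_t‖²`. It
also keeps `‖pⁱ_t‖` between `e^{∓κM}` times its terminal size. Together these give `2μL ≤ ‖∇L‖² ≤ Q
L` (`IsAdmissible.gradient_bounds`).

The linearization of `L` on bounded sets has a quadratic error
(`IsAdmissible.exists_risk_expansion`). This yields both differentiability and the descent
inequality. For small `η`, each step inside the ball multiplies `L` by at most `1 - ημ`; since `‖∇L‖
≤ √Q √L`, the step lengths are bounded by a geometric sequence with sum `2√Q √L(v₀) / μ`. The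
smallness hypothesis says exactly that this sum is at most `R` (`gradDescent_converges`). -/

/-! ### Absolutely continuous paths on the unit interval -/

/-- The path `z` is the primitive on `[0,1]` of the integrable function `z'`. -/
def IsPrimitive {E : Type*} [NormedAddCommGroup E] [NormedSpace ℝ E] (z z' : ℝ → E) : Prop :=
  IntervalIntegrable z' volume 0 1 ∧ ∀ t ∈ Icc (0 : ℝ) 1, z t = z 0 + ∫ s in (0 : ℝ)..t, z' s

/-- The sums that define absolute continuity of `f` are dominated by those of `g` and `h`. Two
comparison functions are allowed because an inner product `⟨z, w⟩` varies with both factors. -/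
theorem AbsolutelyContinuousOnInterval.of_dist_le {X Y Z : Type*} [PseudoMetricSpace X]
    [PseudoMetricSpace Y] [PseudoMetricSpace Z] {f : ℝ → X} {g : ℝ → Y} {h : ℝ → Z} {a b K : ℝ}
    (hg : AbsolutelyContinuousOnInterval g a b) (hh : AbsolutelyContinuousOnInterval h a b)
    (hf : ∀ x ∈ uIcc a b, ∀ y ∈ uIcc a b,
      dist (f x) (f y) ≤ K * (dist (g x) (g y) + dist (h x) (h y))) :
    AbsolutelyContinuousOnInterval f a b := by
  have hlim := (Tendsto.add hg hh).const_mul K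
  simp only [add_zero, mul_zero] at hlim
  refine squeeze_zero' (Eventually.of_forall fun E => Finset.sum_nonneg fun _ _ => dist_nonneg) ?_
    hlim
  have hE : ∀ᶠ E in totalLengthFilter ⊓ 𝓟 (disjWithin a b), E ∈ disjWithin a b :=
    eventually_inf_principal.mpr (by simp)
  filter_upwards [hE] with E hE
  rw [← Finset.sum_add_distrib, Finset.mul_sum]
  exact Finset.sum_le_sum fun i hi => hf _ (hE.1 i hi).1 _ (hE.1 i hi).2

theorem intervalIntegrable_mono_unit {E : Type*} [NormedAddCommGroup E] {f : ℝ → E}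
    (hf : IntervalIntegrable f volume 0 1) {s t : ℝ} (hs : s ∈ Icc (0 : ℝ) 1)
    (ht : t ∈ Icc (0 : ℝ) 1) : IntervalIntegrable f volume s t :=
  hf.mono_set (uIcc_subset_uIcc (by simpa using hs) (by simpa using ht))

namespace IsPrimitive

section Basic

variable {E : Type*} [NormedAddCommGroup E] [NormedSpace ℝ E] {z z' : ℝ → E}

theorem sub_eq_integral (h : IsPrimitive z z') {s t : ℝ} (hs : s ∈ Icc (0 : ℝ) 1)
    (ht : t ∈ Icc (0 : ℝ) 1) : z t - z s = ∫ r in s..t, z' r := by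
  rw [h.2 t ht, h.2 s hs, ← intervalIntegral.integral_interval_sub_left
    (intervalIntegrable_mono_unit h.1 (left_mem_Icc.2 zero_le_one) ht)
    (intervalIntegrable_mono_unit h.1 (left_mem_Icc.2 zero_le_one) hs)]
  abel

/-- The increments of `z` are dominated by those of the real primitive of `‖z'‖`. -/
theorem absolutelyContinuousOnInterval (h : IsPrimitive z z') :
    AbsolutelyContinuousOnInterval z 0 1 := by
  have hN := (h.1.norm).absolutelyContinuousOnInterval_intervalIntegral (c := 0) (by simp)
  refine hN.of_dist_le hN (K := 1) fun x hx y hy => ?_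
  rw [uIcc_of_le zero_le_one] at hx hy
  have h1 : dist (z x) (z y) ≤ dist (∫ v in (0 : ℝ)..x, ‖z' v‖) (∫ v in (0 : ℝ)..y, ‖z' v‖) := by
    rw [dist_eq_norm, h.sub_eq_integral hy hx, Real.dist_eq,
      intervalIntegral.integral_interval_sub_left
        (intervalIntegrable_mono_unit h.1.norm (by simp) hx)
        (intervalIntegrable_mono_unit h.1.norm (by simp) hy)]
    exact intervalIntegral.norm_integral_le_abs_integral_norm
  rw [one_mul]
  exact h1.trans (le_add_of_nonneg_right dist_nonneg)

theorem continuousOn (h : IsPrimitive z z') : ContinuousOn z (Icc 0 1) := by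
  simpa using h.absolutelyContinuousOnInterval.continuousOn

theorem ae_hasDerivAt [CompleteSpace E] (h : IsPrimitive z z') :
    ∀ᵐ t, t ∈ Ioo (0 : ℝ) 1 → HasDerivAt z (z' t) t := by
  filter_upwards [h.1.ae_hasDerivAt_integral] with t ht htm
  have h1 := (ht (by simpa using Ioo_subset_Icc_self htm) 0 (by simp)).const_add (z 0)
  refine h1.congr_of_eventuallyEq ?_
  filter_upwards [Ioo_mem_nhds htm.1 htm.2] with s hs
  exact h.2 s (Ioo_subset_Icc_self hs)

theorem sub {w w' : ℝ → E} (h : IsPrimitive z z') (hw : IsPrimitive w w') :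
    IsPrimitive (fun t => z t - w t) (fun t => z' t - w' t) := by
  refine ⟨h.1.sub hw.1, fun t ht => ?_⟩
  rw [intervalIntegral.integral_sub (intervalIntegrable_mono_unit h.1 (by simp) ht)
    (intervalIntegrable_mono_unit hw.1 (by simp) ht)]
  simp only [h.2 t ht, hw.2 t ht]
  abel

theorem reverse (h : IsPrimitive z z') :
    IsPrimitive (fun t => z (1 - t)) (fun t => -z' (1 - t)) := by
  refine ⟨?_, fun t ht => ?_⟩
  · simpa [Pi.neg_def] using (h.1.comp_sub_left 1).symm.neg
  · have := h.sub_eq_integral (s := 1 - t) (t := 1)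
      ⟨by linarith [ht.2], by linarith [ht.1]⟩ (by simp)
    rw [intervalIntegral.integral_neg, intervalIntegral.integral_comp_sub_left (fun s => z' s) 1,
      sub_zero, ← this]
    simp

end Basic

/-- The fundamental theorem of calculus for absolutely continuous functions. It reduces the rules
for inner products, products and exponentials to absolute continuity plus the pointwise rule at
almost every time. -/
theorem of_ae_hasDerivAt {f f' : ℝ → ℝ} (hf : AbsolutelyContinuousOnInterval f 0 1)
    (h : ∀ᵐ t, t ∈ Ioo (0 : ℝ) 1 → HasDerivAt f (f' t) t) : IsPrimitive f f' := by
  have hone : ∀ᵐ t : ℝ, t ≠ 1 := by simp [ae_iff]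
  have hae : ∀ᵐ t, t ∈ Ioc (0 : ℝ) 1 → deriv f t = f' t := by
    filter_upwards [h, hone] with t ht h1 htm
    exact (ht ⟨htm.1, lt_of_le_of_ne htm.2 h1⟩).deriv
  refine ⟨?_, fun t ht => ?_⟩
  · refine hf.intervalIntegrable_deriv.congr_ae ?_
    rw [uIoc_of_le zero_le_one]
    exact (ae_restrict_iff' measurableSet_Ioc).2 hae
  · have h1 := (hf.mono (c := 0) (d := t)
      (uIcc_subset_uIcc (by simp) (by simpa using ht))).integral_deriv_eq_sub
    have h2 : ∫ s in (0 : ℝ)..t, deriv f s = ∫ s in (0 : ℝ)..t, f' s := by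
      refine intervalIntegral.integral_congr_ae ?_
      filter_upwards [hae] with s hs hsm
      rw [uIoc_of_le ht.1] at hsm
      exact hs ⟨hsm.1, hsm.2.trans ht.2⟩
    rw [← h2, h1]
    ring

theorem real_inner {E : Type*} [NormedAddCommGroup E] [InnerProductSpace ℝ E] [CompleteSpace E]
    {z z' w w' : ℝ → E} (hz : IsPrimitive z z') (hw : IsPrimitive w w') :
    IsPrimitive (fun t => inner ℝ (z t) (w t))
      (fun t => inner ℝ (z t) (w' t) + inner ℝ (z' t) (w t)) := by
  obtain ⟨C, hC⟩ := hz.absolutelyContinuousOnInterval.exists_bound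
  obtain ⟨D, hD⟩ := hw.absolutelyContinuousOnInterval.exists_bound
  refine of_ae_hasDerivAt (hz.absolutelyContinuousOnInterval.of_dist_le
    hw.absolutelyContinuousOnInterval (K := max C D) fun x hx y hy => ?_) ?_
  · have h1 : inner ℝ (z x) (w x) - inner ℝ (z y) (w y) =
        inner ℝ (z x - z y) (w x) + inner ℝ (z y) (w x - w y) := by
      rw [inner_sub_left, inner_sub_right]; ring
    rw [Real.dist_eq, h1, dist_eq_norm, dist_eq_norm]
    calc |inner ℝ (z x - z y) (w x) + inner ℝ (z y) (w x - w y)|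
        ≤ ‖z x - z y‖ * ‖w x‖ + ‖z y‖ * ‖w x - w y‖ :=
          (abs_add_le _ _).trans (add_le_add (abs_real_inner_le_norm _ _)
            (abs_real_inner_le_norm _ _))
      _ ≤ ‖z x - z y‖ * max C D + max C D * ‖w x - w y‖ := by
          gcongr
          · exact (hD x hx).trans (le_max_right _ _)
          · exact (hC y hy).trans (le_max_left _ _)
      _ = _ := by ring
  · filter_upwards [hz.ae_hasDerivAt, hw.ae_hasDerivAt] with t h1 h2 ht
    exact (h1 ht).inner ℝ (h2 ht)

theorem mul {f f' g g' : ℝ → ℝ} (hf : IsPrimitive f f') (hg : IsPrimitive g g') :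
    IsPrimitive (fun t => f t * g t) (fun t => f' t * g t + f t * g' t) := by
  refine of_ae_hasDerivAt (hf.absolutelyContinuousOnInterval.fun_mul
    hg.absolutelyContinuousOnInterval) ?_
  filter_upwards [hf.ae_hasDerivAt, hg.ae_hasDerivAt] with t h1 h2 ht
  exact (h1 ht).mul (h2 ht)

theorem exp {f f' : ℝ → ℝ} (hf : IsPrimitive f f') :
    IsPrimitive (fun t => Real.exp (f t)) (fun t => Real.exp (f t) * f' t) := by
  obtain ⟨C, hC⟩ := hf.absolutelyContinuousOnInterval.exists_bound
  refine of_ae_hasDerivAt (hf.absolutelyContinuousOnInterval.of_dist_le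
    hf.absolutelyContinuousOnInterval (K := Real.exp C) fun x hx y hy => ?_) ?_
  · have hmem : ∀ x ∈ uIcc (0 : ℝ) 1, f x ∈ Iic C := fun x hx =>
      (le_abs_self _).trans (hC x hx)
    have h1 := (convex_Iic C).norm_image_sub_le_of_norm_hasDerivWithin_le
      (f := Real.exp) (f' := Real.exp) (C := Real.exp C)
      (fun u _ => (Real.hasDerivAt_exp u).hasDerivWithinAt)
      (fun u hu => by simpa using hu) (hmem y hy) (hmem x hx)
    rw [dist_eq_norm, dist_eq_norm]
    refine h1.trans ?_
    gcongr
    exact le_add_of_nonneg_left (norm_nonneg _)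
  · filter_upwards [hf.ae_hasDerivAt] with t h1 ht
    exact (h1 ht).exp

theorem integral {E : Type*} [NormedAddCommGroup E] [NormedSpace ℝ E] {f : ℝ → E}
    (hf : IntervalIntegrable f volume 0 1) : IsPrimitive (fun t => ∫ s in (0 : ℝ)..t, f s) f :=
  ⟨hf, fun t _ => by simp⟩

/-! ### Grönwall inequalities -/

/-- With the integrating factor `e^{-G}`, `G = ∫ l`, the derivative of `e^{-G} Y` is at most `e^{-G}
b`. No sign is imposed on `l`, so the same inequality also yields lower bounds. -/
theorem le_exp_mul {Y Y' l b : ℝ → ℝ} (hY : IsPrimitive Y Y')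
    (hl : IntervalIntegrable l volume 0 1) (hb : IntervalIntegrable b volume 0 1)
    (h : ∀ᵐ t, t ∈ Ioo (0 : ℝ) 1 → Y' t ≤ l t * Y t + b t) {t : ℝ} (ht : t ∈ Icc (0 : ℝ) 1) :
    Y t ≤ Real.exp (∫ s in (0 : ℝ)..t, l s) *
      (Y 0 + ∫ s in (0 : ℝ)..t, Real.exp (-∫ r in (0 : ℝ)..s, l r) * b s) := by
  set G : ℝ → ℝ := fun t => ∫ s in (0 : ℝ)..t, l s with hG
  have hGp : IsPrimitive (fun t => -G t) (fun t => -l t) := by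
    simpa [hG, intervalIntegral.integral_neg, Pi.neg_def] using IsPrimitive.integral hl.neg
  have hE := hGp.exp
  have hP := hE.mul hY
  have h1 := hP.2 t ht
  have hone : ∀ᵐ t : ℝ, t ≠ 1 := by simp [ae_iff]
  have h2 : ∫ s in (0 : ℝ)..t, (Real.exp (-G s) * -l s * Y s + Real.exp (-G s) * Y' s) ≤
      ∫ s in (0 : ℝ)..t, Real.exp (-G s) * b s := by
    refine intervalIntegral.integral_mono_ae_restrict ht.1
      (intervalIntegrable_mono_unit hP.1 (by simp) ht)
      (intervalIntegrable_mono_unit (hb.continuousOn_mul (by simpa using hE.continuousOn))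
        (by simp) ht) ?_
    refine (ae_restrict_iff' measurableSet_Icc).2 ?_
    have hzero : ∀ᵐ t : ℝ, t ≠ 0 := by simp [ae_iff]
    filter_upwards [h, hone, hzero] with s hs h1 h0 hsm
    have := hs ⟨lt_of_le_of_ne hsm.1 h0.symm, lt_of_le_of_ne (hsm.2.trans ht.2) h1⟩
    have := mul_le_mul_of_nonneg_left this (Real.exp_pos (-G s)).le
    linarith
  have h3 : Real.exp (-G t) * Y t ≤ Y 0 + ∫ s in (0 : ℝ)..t, Real.exp (-G s) * b s := by
    refine h1.trans_le ?_
    simpa [hG] using h2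
  calc Y t = Real.exp (G t) * (Real.exp (-G t) * Y t) := by
        rw [← mul_assoc, ← Real.exp_add]; simp
    _ ≤ _ := mul_le_mul_of_nonneg_left h3 (Real.exp_pos _).le

section Norm

variable {E : Type*} [NormedAddCommGroup E] [InnerProductSpace ℝ E] [CompleteSpace E]
  {w w' : ℝ → E} {l : ℝ → ℝ}

/-- Grönwall for `‖w‖²`, whose derivative is at most `2 l ‖w‖²`; squaring avoids the failure of
differentiability of the norm at `0`. -/
theorem norm_le_exp_mul (hw : IsPrimitive w w') (hl : IntervalIntegrable l volume 0 1)
    (h : ∀ᵐ t, t ∈ Ioo (0 : ℝ) 1 → ‖w' t‖ ≤ l t * ‖w t‖) {t : ℝ} (ht : t ∈ Icc (0 : ℝ) 1) :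
    ‖w t‖ ≤ Real.exp (∫ s in (0 : ℝ)..t, l s) * ‖w 0‖ := by
  have hder : ∀ᵐ t, t ∈ Ioo (0 : ℝ) 1 → (inner ℝ (w t) (w' t) + inner ℝ (w' t) (w t) : ℝ) ≤
      2 * l t * inner ℝ (w t) (w t) + 0 := by
    filter_upwards [h] with t h ht
    have h2 := real_inner_le_norm (w t) (w' t)
    have h3 := mul_le_mul_of_nonneg_left (h ht) (norm_nonneg (w t))
    rw [real_inner_self_eq_norm_sq, real_inner_comm (w t) (w' t)]
    nlinarith
  have h1 := le_exp_mul (hw.real_inner hw) (hl.const_mul 2) (b := fun _ => 0) (by simp) hder ht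
  simp only [real_inner_self_eq_norm_sq, intervalIntegral.integral_const_mul, mul_zero,
    intervalIntegral.integral_zero, add_zero] at h1
  refine le_of_sq_le_sq ?_ (by positivity)
  rwa [mul_pow, ← Real.exp_nat_mul]

/-- The function `-‖w‖²` satisfies a Grönwall inequality with coefficient `-2 l`: a path whose
relative speed is at most `l` cannot shrink faster than `e^{-∫ l}`. -/
theorem exp_neg_mul_norm_le (hw : IsPrimitive w w') (hl : IntervalIntegrable l volume 0 1)
    (h : ∀ᵐ t, t ∈ Ioo (0 : ℝ) 1 → ‖w' t‖ ≤ l t * ‖w t‖) {t : ℝ} (ht : t ∈ Icc (0 : ℝ) 1) :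
    Real.exp (-∫ s in (0 : ℝ)..t, l s) * ‖w 0‖ ≤ ‖w t‖ := by
  have hn : IsPrimitive (fun t => -(inner ℝ (w t) (w t) : ℝ))
      (fun t => -(inner ℝ (w t) (w' t) + inner ℝ (w' t) (w t))) := by
    refine ⟨(hw.real_inner hw).1.neg, fun t ht => ?_⟩
    rw [intervalIntegral.integral_neg]
    simp only [(hw.real_inner hw).2 t ht]
    ring
  have hder : ∀ᵐ t, t ∈ Ioo (0 : ℝ) 1 → -(inner ℝ (w t) (w' t) + inner ℝ (w' t) (w t) : ℝ) ≤
      -2 * l t * -inner ℝ (w t) (w t) + 0 := by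
    filter_upwards [h] with t h ht
    have h2 := neg_le_of_abs_le (abs_real_inner_le_norm (w t) (w' t))
    have h3 := mul_le_mul_of_nonneg_left (h ht) (norm_nonneg (w t))
    rw [real_inner_self_eq_norm_sq, real_inner_comm (w t) (w' t)]
    nlinarith
  have h1 := le_exp_mul hn (hl.const_mul (-2)) (b := fun _ => 0) (by simp) hder ht
  simp only [real_inner_self_eq_norm_sq, intervalIntegral.integral_const_mul, mul_zero,
    intervalIntegral.integral_zero, add_zero] at h1
  refine le_of_sq_le_sq ?_ (norm_nonneg _)
  rw [mul_pow, ← Real.exp_nat_mul]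
  have h4 : ((2 : ℕ) : ℝ) * -∫ s in (0 : ℝ)..t, l s = -2 * ∫ s in (0 : ℝ)..t, l s := by
    push_cast; ring
  rw [h4]
  linarith

end Norm

theorem norm_le_exp_mul_integral {E : Type*} [NormedAddCommGroup E] [NormedSpace ℝ E]
    {w w' : ℝ → E} {l b : ℝ → ℝ} (hw : IsPrimitive w w') (h0 : w 0 = 0)
    (hl : IntervalIntegrable l volume 0 1) (hb : IntervalIntegrable b volume 0 1)
    (hl0 : ∀ t, 0 ≤ l t) (hb0 : ∀ t, 0 ≤ b t) (h : ∀ t ∈ Icc (0 : ℝ) 1, ‖w' t‖ ≤ l t * ‖w t‖ + b t)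
    {t : ℝ} (ht : t ∈ Icc (0 : ℝ) 1) :
    ‖w t‖ ≤ Real.exp (∫ s in (0 : ℝ)..1, l s) * ∫ s in (0 : ℝ)..1, b s := by
  have hlb : IntervalIntegrable (fun s => l s * ‖w s‖ + b s) volume 0 1 :=
    (hl.mul_continuousOn (by simpa using hw.continuousOn.norm)).add hb
  have hY := IsPrimitive.integral hlb
  -- The primitive `Y` of `l ‖w‖ + b` dominates `‖w‖`, hence satisfies `Y' ≤ l Y + b` itself; the
  -- norm need not be differentiated.
  have hle : ∀ t ∈ Icc (0 : ℝ) 1, ‖w t‖ ≤ ∫ s in (0 : ℝ)..t, (l s * ‖w s‖ + b s) := by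
    intro t ht
    rw [hw.2 t ht, h0, zero_add]
    refine intervalIntegral.norm_integral_le_of_norm_le ht.1 ?_
      (intervalIntegrable_mono_unit hlb (by simp) ht)
    exact Eventually.of_forall fun s hs => h s ⟨hs.1.le, hs.2.trans ht.2⟩
  have h1 := le_exp_mul hY hl hb (Eventually.of_forall fun s hs => by
    have := hle s (Ioo_subset_Icc_self hs)
    have := mul_le_mul_of_nonneg_left this (hl0 s)
    linarith) ht
  refine (hle t ht).trans (h1.trans ?_)
  have hmono : ∀ {f : ℝ → ℝ}, IntervalIntegrable f volume 0 1 → (∀ s, 0 ≤ f s) →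
      ∫ s in (0 : ℝ)..t, f s ≤ ∫ s in (0 : ℝ)..1, f s := fun {f} hf hf0 =>
    intervalIntegral.integral_mono_interval le_rfl ht.1 ht.2
      (Eventually.of_forall fun s => hf0 s) hf
  have hGc : ContinuousOn (fun s => Real.exp (-∫ r in (0 : ℝ)..s, l r)) (uIcc 0 1) := by
    rw [uIcc_of_le zero_le_one]
    exact Real.continuous_exp.comp_continuousOn (IsPrimitive.integral hl).continuousOn.neg
  have h2 : ∫ s in (0 : ℝ)..t, Real.exp (-∫ r in (0 : ℝ)..s, l r) * b s ≤
      ∫ s in (0 : ℝ)..t, b s := by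
    refine intervalIntegral.integral_mono_on ht.1
      (intervalIntegrable_mono_unit (hb.continuousOn_mul hGc) (by simp) ht)
      (intervalIntegrable_mono_unit hb (by simp) ht) fun s hs => ?_
    refine mul_le_of_le_one_left (hb0 s) (Real.exp_le_one_iff.2 (neg_nonpos.2 ?_))
    exact intervalIntegral.integral_nonneg hs.1 fun r _ => hl0 r
  simp only [intervalIntegral.integral_same, zero_add]
  have h3 : 0 ≤ ∫ s in (0 : ℝ)..1, b s := intervalIntegral.integral_nonneg zero_le_one
    fun r _ => hb0 r
  calc _ ≤ Real.exp (∫ s in (0 : ℝ)..t, l s) * ∫ s in (0 : ℝ)..1, b s := by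
        gcongr
        exact h2.trans (hmono hb hb0)
    _ ≤ _ := by
        gcongr
        exact hmono hl hl0

end IsPrimitive

/-! ### Carathéodory existence theorem -/

/-- Picard iteration in the weighted unknown `w = e^{-2G} z`, `G = ∫ l`. Since `∫₀ᵗ l e^{2G} =
(e^{2G(t)} - 1) / 2`, the integral operator contracts by `1/2` on all of `[0,1]` at once, however
large `∫ l` is. -/
theorem exists_integral_solution {E : Type*} [NormedAddCommGroup E] [NormedSpace ℝ E]
    [CompleteSpace E] (f : ℝ → E → E) {l : ℝ → ℝ} (hl : IntervalIntegrable l volume 0 1)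
    (hint : ∀ z : ℝ → E, Continuous z → IntervalIntegrable (fun s => f s (z s)) volume 0 1)
    (hlip : ∀ s x y, ‖f s x - f s y‖ ≤ l s * ‖x - y‖) (hl0 : ∀ s, 0 ≤ l s) (a : E) :
    ∃ z : ℝ → E, Continuous z ∧
      ∀ t ∈ Icc (0 : ℝ) 1, z t = a + ∫ s in (0 : ℝ)..t, f s (z s) := by
  have h01 : (0 : ℝ) ≤ 1 := zero_le_one
  set G : ℝ → ℝ := fun t => ∫ s in (0 : ℝ)..t, l s with hG
  have hGp : IsPrimitive (fun t => 2 * G t) (fun t => 2 * l t) := by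
    simpa [hG, intervalIntegral.integral_const_mul] using
      IsPrimitive.integral (hl.const_mul 2)
  -- The weight is extended by constants outside `[0,1]`, because `hint` asks for paths continuous
  -- on the whole line.
  set e : ℝ → ℝ := IccExtend h01 (domRestrict (Icc 0 1) fun t => Real.exp (2 * G t)) with he
  have hec : Continuous e := (continuousOn_iff_continuous_domRestrict.1 hGp.exp.continuousOn).Icc_extend'
  have hepos : ∀ t, 0 < e t := fun t => Real.exp_pos _
  have heq : ∀ t ∈ Icc (0 : ℝ) 1, e t = Real.exp (2 * G t) := fun t ht => by
    simp [he, IccExtend_of_mem h01 _ ht, domRestrict]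
  have hint_e : ∀ t ∈ Icc (0 : ℝ) 1, ∫ s in (0 : ℝ)..t, l s * e s = (e t - 1) / 2 := by
    intro t ht
    have h1 := hGp.exp.2 t ht
    have h2 : ∫ s in (0 : ℝ)..t, Real.exp (2 * G s) * (2 * l s) =
        2 * ∫ s in (0 : ℝ)..t, l s * e s := by
      rw [← intervalIntegral.integral_const_mul]
      refine intervalIntegral.integral_congr fun s hs => ?_
      rw [uIcc_of_le ht.1] at hs
      simp only [heq s ⟨hs.1, hs.2.trans ht.2⟩]
      ring
    simp only [h2, ← heq t ht] at h1
    simp [hG] at h1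
    linarith
  let ext : C(Icc (0 : ℝ) 1, E) → ℝ → E := fun w s => e s • IccExtend h01 w s
  have hext : ∀ w, Continuous (ext w) := fun w => hec.smul w.continuous.Icc_extend'
  let J : C(Icc (0 : ℝ) 1, E) → ℝ → E := fun w t => a + ∫ s in (0 : ℝ)..t, f s (ext w s)
  have hJ : ∀ w, ContinuousOn (J w) (Icc 0 1) := fun w =>
    continuousOn_const.add (IsPrimitive.integral (hint _ (hext w))).continuousOn
  let Φ : C(Icc (0 : ℝ) 1, E) → C(Icc (0 : ℝ) 1, E) := fun w =>
    ⟨domRestrict (Icc 0 1) fun t => (e t)⁻¹ • J w t, continuousOn_iff_continuous_domRestrict.1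
      ((hec.inv₀ fun t => (hepos t).ne').continuousOn.smul (hJ w))⟩
  have hΦ : ContractingWith (1 / 2) Φ := by
    refine ⟨by norm_num, LipschitzWith.of_dist_le_mul fun w w' => ?_⟩
    rw [ContinuousMap.dist_le (by positivity)]
    rintro ⟨t, ht⟩
    have h1 : J w t - J w' t = ∫ s in (0 : ℝ)..t, (f s (ext w s) - f s (ext w' s)) := by
      rw [intervalIntegral.integral_sub
        (intervalIntegrable_mono_unit (hint _ (hext w)) (by simp) ht)
        (intervalIntegrable_mono_unit (hint _ (hext w')) (by simp) ht)]
      simp [J]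
    have h2 : ‖J w t - J w' t‖ ≤ ∫ s in (0 : ℝ)..t, l s * e s * dist w w' := by
      rw [h1]
      refine intervalIntegral.norm_integral_le_of_norm_le ht.1
        (Eventually.of_forall fun s hs => ?_) (intervalIntegrable_mono_unit
          ((hl.mul_continuousOn hec.continuousOn).mul_const _) (by simp) ht)
      refine (hlip s _ _).trans ?_
      rw [mul_assoc]
      gcongr
      · exact hl0 s
      · rw [← smul_sub, norm_smul, Real.norm_of_nonneg (hepos s).le]
        gcongr
        · exact (hepos s).le
        · rw [← dist_eq_norm]
          exact ContinuousMap.dist_apply_le_dist _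
    rw [intervalIntegral.integral_mul_const, hint_e t ht] at h2
    change dist ((e t)⁻¹ • J w t) ((e t)⁻¹ • J w' t) ≤ _
    rw [dist_eq_norm, ← smul_sub, norm_smul, norm_inv, Real.norm_of_nonneg (hepos t).le,
      inv_mul_le_iff₀ (hepos t)]
    refine h2.trans ?_
    push_cast
    have := hepos t
    have hd : 0 ≤ dist w w' := dist_nonneg
    nlinarith
  have : Nonempty C(Icc (0 : ℝ) 1, E) := ⟨0⟩
  set w := hΦ.fixedPoint Φ
  have hfix : Φ w = w := hΦ.fixedPoint_isFixedPt
  refine ⟨ext w, hext w, fun t ht => ?_⟩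
  have h1 : (e t)⁻¹ • J w t = w ⟨t, ht⟩ := congrArg (fun u => u ⟨t, ht⟩) hfix
  change e t • IccExtend h01 w t = J w t
  rw [IccExtend_of_mem h01 _ ht, ← h1, smul_inv_smul₀ (hepos t).ne']

/-! ### Admissible reproducing kernel Hilbert spaces -/

namespace IsAdmissible

variable {q : ℕ} {V : Type*} [NormedAddCommGroup V] [InnerProductSpace ℝ V]
  [RKHS ℝ V (Euc q) (Euc q)] {κ : ℝ}

theorem norm_le_of_enorm_le {F : Type*} [NormedAddCommGroup F] {x : F} {c : ℝ} (hc : 0 ≤ c)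
    (h : ‖x‖ₑ ≤ ENNReal.ofReal c) : ‖x‖ ≤ c := by
  rwa [← ofReal_norm, ENNReal.ofReal_le_ofReal_iff hc] at h

theorem norm_apply_le (h : IsAdmissible V κ) (v : V) (z : Euc q) : ‖v z‖ ≤ κ * ‖v‖ := by
  refine norm_le_of_enorm_le (mul_nonneg h.1.le (norm_nonneg v)) (le_trans ?_ (h.2 v).2)
  rw [w2InftyNorm, add_assoc]
  exact (le_iSup (fun z => ‖v z‖ₑ) z).trans le_self_add

theorem norm_fderiv_le (h : IsAdmissible V κ) (v : V) (z : Euc q) :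
    ‖fderiv ℝ (v : Euc q → Euc q) z‖ ≤ κ * ‖v‖ := by
  refine norm_le_of_enorm_le (mul_nonneg h.1.le (norm_nonneg v)) (le_trans ?_ (h.2 v).2)
  rw [w2InftyNorm]
  exact (le_iSup (fun z => ‖fderiv ℝ (v : Euc q → Euc q) z‖ₑ) z).trans
    (le_add_self.trans le_self_add)

theorem norm_fderiv_sub_le (h : IsAdmissible V κ) (v : V) (z z' : Euc q) :
    ‖fderiv ℝ (v : Euc q → Euc q) z - fderiv ℝ (v : Euc q → Euc q) z'‖ ≤
      κ * ‖v‖ * ‖z - z'‖ := by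
  have hκ : 0 ≤ κ * ‖v‖ := mul_nonneg h.1.le (norm_nonneg v)
  rcases eq_or_ne z z' with rfl | hne
  · simp
  refine norm_le_of_enorm_le (by positivity) ?_
  have h1 : ‖fderiv ℝ (v : Euc q → Euc q) z - fderiv ℝ (v : Euc q → Euc q) z'‖ₑ / ‖z - z'‖ₑ ≤
      ENNReal.ofReal (κ * ‖v‖) := by
    refine le_trans ?_ (h.2 v).2
    rw [w2InftyNorm]
    exact (le_iSup₂ (f := fun z z' => ‖fderiv ℝ (v : Euc q → Euc q) z -
      fderiv ℝ (v : Euc q → Euc q) z'‖ₑ / ‖z - z'‖ₑ) z z').trans le_add_self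
  rw [ENNReal.div_le_iff (by simpa [sub_eq_zero] using hne) (by simp)] at h1
  rwa [ENNReal.ofReal_mul hκ, ofReal_norm]

theorem differentiable (h : IsAdmissible V κ) (v : V) :
    Differentiable ℝ (v : Euc q → Euc q) :=
  (h.2 v).1.differentiable (by simp)

theorem norm_apply_sub_le (h : IsAdmissible V κ) (v : V) (z z' : Euc q) :
    ‖v z - v z'‖ ≤ κ * ‖v‖ * ‖z - z'‖ :=
  convex_univ.norm_image_sub_le_of_norm_fderiv_le (fun x _ => h.differentiable v x)
    (fun x _ => h.norm_fderiv_le v x) (mem_univ z') (mem_univ z)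

/-- The mean value inequality on the segment for `v` minus its linear part at `z`; the optimal
factor `1/2` is not needed. -/
theorem norm_apply_sub_sub_fderiv_le (h : IsAdmissible V κ) (v : V) (z z' : Euc q) :
    ‖v z' - v z - fderiv ℝ (v : Euc q → Euc q) z (z' - z)‖ ≤ κ * ‖v‖ * ‖z' - z‖ ^ 2 := by
  have hκ : 0 ≤ κ * ‖v‖ := mul_nonneg h.1.le (norm_nonneg v)
  have h1 := (convex_segment z z').norm_image_sub_le_of_norm_fderiv_le'
    (f := (v : Euc q → Euc q)) (φ := fderiv ℝ (v : Euc q → Euc q) z) (C := κ * ‖v‖ * ‖z' - z‖)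
    (fun x _ => h.differentiable v x) (fun x hx => (h.norm_fderiv_sub_le v x z).trans (by
      gcongr
      exact norm_sub_le_of_mem_segment hx)) (left_mem_segment ℝ z z') (right_mem_segment ℝ z z')
  rw [pow_two, ← mul_assoc]
  exact h1

/-- Joint continuity makes `s ↦ v_s(z_s)` measurable when `v` is only almost everywhere strongly
measurable in time. `continuous_fderiv` plays the same role for the adjoint equation. -/
theorem continuous_apply (h : IsAdmissible V κ) :
    Continuous fun p : V × Euc q => p.1 p.2 := by
  refine continuous_iff_continuousAt.2 fun p => tendsto_iff_norm_sub_tendsto_zero.2 ?_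
  have hlim : Tendsto (fun r : V × Euc q => κ * ‖r.1 - p.1‖ + κ * ‖p.1‖ * ‖r.2 - p.2‖) (𝓝 p)
      (𝓝 (κ * ‖p.1 - p.1‖ + κ * ‖p.1‖ * ‖p.2 - p.2‖)) :=
    Continuous.tendsto (by fun_prop) p
  simp only [sub_self, norm_zero, mul_zero, add_zero] at hlim
  refine squeeze_zero (fun _ => norm_nonneg _) (fun r => ?_) hlim
  have h1 : r.1 r.2 - p.1 p.2 = (r.1 - p.1) r.2 + (p.1 r.2 - p.1 p.2) := by
    rw [RKHS.coe_sub, Pi.sub_apply]; abel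
  rw [h1]
  exact (norm_add_le _ _).trans (add_le_add (h.norm_apply_le _ _) (h.norm_apply_sub_le _ _ _))

theorem continuous_fderiv (h : IsAdmissible V κ) :
    Continuous fun p : V × Euc q => fderiv ℝ (p.1 : Euc q → Euc q) p.2 := by
  refine continuous_iff_continuousAt.2 fun p => tendsto_iff_norm_sub_tendsto_zero.2 ?_
  have hlim : Tendsto (fun r : V × Euc q => κ * ‖r.1 - p.1‖ + κ * ‖p.1‖ * ‖r.2 - p.2‖) (𝓝 p)
      (𝓝 (κ * ‖p.1 - p.1‖ + κ * ‖p.1‖ * ‖p.2 - p.2‖)) :=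
    Continuous.tendsto (by fun_prop) p
  simp only [sub_self, norm_zero, mul_zero, add_zero] at hlim
  refine squeeze_zero (fun _ => norm_nonneg _) (fun r => ?_) hlim
  have h1 : fderiv ℝ (r.1 : Euc q → Euc q) r.2 - fderiv ℝ (p.1 : Euc q → Euc q) p.2 =
      fderiv ℝ ((r.1 - p.1 : V) : Euc q → Euc q) r.2 +
        (fderiv ℝ (p.1 : Euc q → Euc q) r.2 - fderiv ℝ (p.1 : Euc q → Euc q) p.2) := by
    rw [RKHS.coe_sub, fderiv_sub (h.differentiable _ _) (h.differentiable _ _)]; abel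
  rw [h1]
  exact (norm_add_le _ _).trans (add_le_add (h.norm_fderiv_le _ _) (h.norm_fderiv_sub_le _ _ _))

/-- Duality: `k = (K_z - K_{z'}) p` satisfies `‖k‖² = ⟨k(z) - k(z'), p⟩ ≤ κ ‖k‖ ‖z - z'‖ ‖p‖`, so
kernel sections depend on the point in a `κ`-Lipschitz way. This makes the gradient continuous in
time. -/
theorem continuous_kerFun [CompleteSpace V] (h : IsAdmissible V κ) :
    Continuous fun z : Euc q => RKHS.kerFun V z := by
  have hL : LipschitzWith κ.toNNReal fun z : Euc q => RKHS.kerFun V z := by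
    refine LipschitzWith.of_dist_le_mul fun z z' => ?_
    rw [Real.coe_toNNReal κ h.1.le, dist_eq_norm, dist_eq_norm]
    refine ContinuousLinearMap.opNorm_le_bound _ (mul_nonneg h.1.le (norm_nonneg _)) fun p => ?_
    have h0 : ∀ u : V, inner ℝ u ((RKHS.kerFun V z - RKHS.kerFun V z') p) =
        inner ℝ (u z - u z') p := fun u => by
      rw [sub_apply, inner_sub_right, RKHS.inner_kerFun, RKHS.inner_kerFun, inner_sub_left]
    set k : V := (RKHS.kerFun V z - RKHS.kerFun V z') p
    have h1 : ‖k‖ ^ 2 = inner ℝ (k z - k z') p := by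
      rw [← real_inner_self_eq_norm_sq, h0 k]
    have h2 : ‖k‖ * ‖k‖ ≤ ‖k‖ * (κ * ‖z - z'‖ * ‖p‖) := by
      rw [← pow_two, h1]
      refine (real_inner_le_norm _ _).trans ?_
      have := mul_le_mul_of_nonneg_right (h.norm_apply_sub_le k z z') (norm_nonneg p)
      linarith
    rcases (norm_nonneg k).eq_or_lt with h0 | h0
    · rw [← h0]
      have := h.1.le
      positivity
    · exact le_of_mul_le_mul_left h2 h0
  exact hL.continuous

end IsAdmissible

/-! ### Controls -/

instance isProbabilityMeasure_restrict_unitInterval :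
    IsProbabilityMeasure (volume.restrict (Icc (0 : ℝ) 1)) :=
  ⟨by simp⟩

theorem intervalIntegral_unit_eq {E : Type*} [NormedAddCommGroup E] [NormedSpace ℝ E]
    (f : ℝ → E) : ∫ s in (0 : ℝ)..1, f s = ∫ s, f s ∂(volume.restrict (Icc (0 : ℝ) 1)) := by
  rw [intervalIntegral.integral_of_le zero_le_one, integral_Icc_eq_integral_Ioc]

theorem intervalIntegrable_unit_iff {E : Type*} [NormedAddCommGroup E] {f : ℝ → E} :
    IntervalIntegrable f volume 0 1 ↔ Integrable f (volume.restrict (Icc (0 : ℝ) 1)) :=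
  intervalIntegrable_iff_integrableOn_Icc_of_le zero_le_one

/-- Backward linear equations with integrable coefficients. -/
theorem exists_linear_backward_solution {E : Type*} [NormedAddCommGroup E]
    [InnerProductSpace ℝ E] [CompleteSpace E] {D : ℝ → E →L[ℝ] E} {l : ℝ → ℝ}
    (hDm : AEStronglyMeasurable D (volume.restrict (Icc (0 : ℝ) 1))) (hDn : ∀ s, ‖D s‖ ≤ l s)
    (hl : IntervalIntegrable l volume 0 1) (c : E) :
    ∃ p : ℝ → E, Continuous p ∧ p 1 = c ∧ IsPrimitive p (fun s => -D s (p s)) ∧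
      ∀ t ∈ Icc (0 : ℝ) 1, Real.exp (-∫ s in (0 : ℝ)..1, l s) * ‖c‖ ≤ ‖p t‖ ∧
        ‖p t‖ ≤ Real.exp (∫ s in (0 : ℝ)..1, l s) * ‖c‖ := by
  have hl0 : ∀ s, 0 ≤ l s := fun s => (norm_nonneg _).trans (hDn s)
  have hDi : IntervalIntegrable D volume 0 1 := intervalIntegrable_unit_iff.2
    (Integrable.mono' (intervalIntegrable_unit_iff.1 hl) hDm (Eventually.of_forall hDn))
  have hint : ∀ p : ℝ → E, Continuous p →
      IntervalIntegrable (fun s => D (1 - s) (p s)) volume 0 1 := fun p hp => by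
    have h1 : IntervalIntegrable (fun s => D (1 - s)) volume 0 1 := by
      simpa using (hDi.comp_sub_left 1).symm
    rw [intervalIntegrable_unit_iff] at h1 ⊢
    obtain ⟨C, hC⟩ := isCompact_Icc.exists_bound_of_continuousOn (s := Icc (0 : ℝ) 1)
      hp.continuousOn
    refine Integrable.mono' (h1.norm.mul_const C)
      (isBoundedBilinearMap_apply.continuous.comp_aestronglyMeasurable
        (h1.1.prodMk hp.aestronglyMeasurable)) ?_
    refine (ae_restrict_iff' measurableSet_Icc).2 (Eventually.of_forall fun s hs => ?_)
    exact ((D (1 - s)).le_opNorm _).trans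
      (mul_le_mul_of_nonneg_left (hC s hs) (norm_nonneg _))
  have hlr : IntervalIntegrable (fun s => l (1 - s)) volume 0 1 := by
    simpa using (hl.comp_sub_left 1).symm
  have hDle : ∀ s x, ‖D s x‖ ≤ l s * ‖x‖ := fun s x =>
    ((D s).le_opNorm x).trans (mul_le_mul_of_nonneg_right (hDn s) (norm_nonneg x))
  -- Reversing time turns the terminal condition at `1` into an initial condition.
  obtain ⟨P, hP, hPc⟩ := exists_integral_solution (fun s p => D (1 - s) p) hlr hint
    (fun s x y => by rw [← map_sub]; exact hDle _ _) (fun s => hl0 _) c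
  have hP0 : P 0 = c := by simpa using hPc 0 (by simp)
  have hPp : IsPrimitive P fun s => D (1 - s) (P s) :=
    ⟨hint P hP, by simpa only [hP0] using hPc⟩
  have hbound : ∀ᵐ s, s ∈ Ioo (0 : ℝ) 1 → ‖D (1 - s) (P s)‖ ≤ l (1 - s) * ‖P s‖ :=
    Eventually.of_forall fun s _ => hDle _ _
  refine ⟨fun t => P (1 - t), by fun_prop, by simpa using hP0, by simpa using hPp.reverse,
    fun t ht => ?_⟩
  have ht' : 1 - t ∈ Icc (0 : ℝ) 1 := ⟨by linarith [ht.2], by linarith [ht.1]⟩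
  have hle : ∫ s in (0 : ℝ)..(1 - t), l (1 - s) ≤ ∫ s in (0 : ℝ)..1, l s := by
    rw [intervalIntegral.integral_comp_sub_left (fun s => l s) 1, sub_zero]
    exact intervalIntegral.integral_mono_interval (by linarith [ht.1]) (by linarith [ht.2]) le_rfl
      (Eventually.of_forall fun s => hl0 s) hl
  have h1 := hPp.exp_neg_mul_norm_le hlr hbound ht'
  have h2 := hPp.norm_le_exp_mul hlr hbound ht'
  rw [hP0] at h1 h2
  refine ⟨le_trans ?_ h1, h2.trans ?_⟩ <;> gcongr

namespace Control

variable {V : Type*} [NormedAddCommGroup V]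

theorem integrable (v : Control V) : Integrable v (volume.restrict (Icc (0 : ℝ) 1)) :=
  (Lp.memLp v).integrable one_le_two

theorem intervalIntegrable_norm (v : Control V) :
    IntervalIntegrable (fun s => ‖v s‖) volume 0 1 :=
  intervalIntegrable_unit_iff.2 v.integrable.norm

/-- The time interval has mass one, so the `L¹` norm is at most the `L²` norm. Grönwall exponents
are thereby controlled by `κ ‖v‖`. -/
theorem integral_norm_le (v : Control V) : ∫ s in (0 : ℝ)..1, ‖v s‖ ≤ ‖v‖ := by
  rw [intervalIntegral_unit_eq, integral_norm_eq_lintegral_enorm v.integrable.1,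
    ← eLpNorm_one_eq_lintegral_enorm, Lp.norm_def]
  exact ENNReal.toReal_mono (Lp.eLpNorm_ne_top v)
    (eLpNorm_le_eLpNorm_of_exponent_le one_le_two (Lp.aestronglyMeasurable v))

theorem intervalIntegrable_norm_sub (v w : Control V) :
    IntervalIntegrable (fun s => ‖w s - v s‖) volume 0 1 :=
  intervalIntegrable_unit_iff.2 (w.integrable.sub v.integrable).norm

theorem integral_norm_sub_le (v w : Control V) :
    ∫ s in (0 : ℝ)..1, ‖w s - v s‖ ≤ ‖w - v‖ := by
  refine le_trans (le_of_eq ?_) (integral_norm_le (w - v))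
  rw [intervalIntegral_unit_eq, intervalIntegral_unit_eq]
  refine integral_congr_ae ?_
  filter_upwards [Lp.coeFn_sub w v] with s hs
  rw [hs, Pi.sub_apply]

theorem integral_const_mul_norm_le (v : Control V) {κ M : ℝ} (hκ : 0 ≤ κ) (hv : ‖v‖ ≤ M)
    {t : ℝ} (ht : t ∈ Icc (0 : ℝ) 1) : ∫ s in (0 : ℝ)..t, κ * ‖v s‖ ≤ κ * M := by
  rw [intervalIntegral.integral_const_mul]
  refine mul_le_mul_of_nonneg_left (le_trans ?_ (v.integral_norm_le.trans hv)) hκ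
  exact intervalIntegral.integral_mono_interval le_rfl ht.1 ht.2
    (Eventually.of_forall fun s => norm_nonneg _) v.intervalIntegrable_norm

theorem memLp_of_continuous {f : ℝ → V} (hf : Continuous f) :
    MemLp f 2 (volume.restrict (Icc (0 : ℝ) 1)) := by
  obtain ⟨C, hC⟩ := isCompact_Icc.exists_bound_of_continuousOn (s := Icc (0 : ℝ) 1)
    hf.continuousOn
  exact MemLp.of_bound hf.aestronglyMeasurable C
    ((ae_restrict_iff' measurableSet_Icc).2 (Eventually.of_forall hC))

theorem inner_toLp_sub {H : Type*} [NormedAddCommGroup H] [InnerProductSpace ℝ H] {f : ℝ → H}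
    (hf : Continuous f) (v w : Control H) :
    inner ℝ (memLp_of_continuous hf).toLp (w - v) =
      ∫ s in (0 : ℝ)..1, inner ℝ (f s) (w s - v s) := by
  rw [L2.inner_def, intervalIntegral_unit_eq]
  refine integral_congr_ae ?_
  filter_upwards [(memLp_of_continuous hf).coeFn_toLp, Lp.coeFn_sub w v] with s h1 h2
  rw [h1, h2, Pi.sub_apply]

theorem norm_toLp_sq {H : Type*} [NormedAddCommGroup H] [InnerProductSpace ℝ H] {f : ℝ → H}
    (hf : Continuous f) :
    ‖(memLp_of_continuous hf).toLp‖ ^ 2 = ∫ s in (0 : ℝ)..1, ‖f s‖ ^ 2 := by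
  rw [← real_inner_self_eq_norm_sq, L2.inner_def, intervalIntegral_unit_eq]
  refine integral_congr_ae ?_
  filter_upwards [(memLp_of_continuous hf).coeFn_toLp] with s h1
  rw [h1, real_inner_self_eq_norm_sq]

end Control

/-! ### The flow and the adjoint equation -/

section Flow

variable {q : ℕ} {V : Type*} [NormedAddCommGroup V] [InnerProductSpace ℝ V]
  [RKHS ℝ V (Euc q) (Euc q)] {κ : ℝ}

theorem IsForwardSolution.zero {v : Control V} {a : Euc q} {z : ℝ → Euc q}
    (hz : IsForwardSolution v a z) : z 0 = a := by
  simpa using hz.2.2 0 (by simp)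

theorem IsForwardSolution.isPrimitive {v : Control V} {a : Euc q} {z : ℝ → Euc q}
    (hz : IsForwardSolution v a z) : IsPrimitive z (fun s => (v s : V) (z s)) :=
  ⟨hz.2.1, by simpa only [hz.zero] using hz.2.2⟩

/-- The path `p` solves the adjoint equation `ṗ_t = - Dv_t(z_t)ᵀ p_t` with `p_1 = c`. -/
def IsAdjointSolution (v : Control V) (z : ℝ → Euc q) (c : Euc q) (p : ℝ → Euc q) : Prop :=
  Continuous p ∧ p 1 = c ∧ IsPrimitive p fun s =>
    -ContinuousLinearMap.adjoint (fderiv ℝ (v s : Euc q → Euc q) (z s)) (p s)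

namespace IsAdmissible

theorem integrable_apply (h : IsAdmissible V κ) (v : Control V) {z : ℝ → Euc q}
    (hz : Continuous z) : IntervalIntegrable (fun s => (v s : V) (z s)) volume 0 1 := by
  refine intervalIntegrable_unit_iff.2 (Integrable.mono' (v.integrable.norm.const_mul κ)
    (h.continuous_apply.comp_aestronglyMeasurable
      ((Lp.aestronglyMeasurable v).prodMk hz.aestronglyMeasurable)) ?_)
  exact Eventually.of_forall fun s => h.norm_apply_le _ _

theorem exists_forwardSolution (h : IsAdmissible V κ) (v : Control V) (a : Euc q) :
    ∃ z, Continuous z ∧ IsForwardSolution v a z := by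
  obtain ⟨z, hz, hza⟩ := exists_integral_solution (fun s (x : Euc q) => (v s : V) x)
    (v.intervalIntegrable_norm.const_mul κ) (fun z hz => h.integrable_apply v hz)
    (fun s x y => h.norm_apply_sub_le _ _ _) (fun s => mul_nonneg h.1.le (norm_nonneg _)) a
  exact ⟨z, hz, hz.continuousOn, h.integrable_apply v hz, hza⟩

/-- Grönwall in both directions for the difference of two trajectories. The lower bound prevents
collisions, which universality needs; the upper bound with `a = b` is uniqueness. -/
theorem norm_forward_sub (h : IsAdmissible V κ) {v : Control V} {a b : Euc q}
    {z w : ℝ → Euc q} (hz : IsForwardSolution v a z) (hw : IsForwardSolution v b w) {M : ℝ}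
    (hv : ‖v‖ ≤ M) {t : ℝ} (ht : t ∈ Icc (0 : ℝ) 1) :
    Real.exp (-(κ * M)) * ‖a - b‖ ≤ ‖z t - w t‖ ∧
      ‖z t - w t‖ ≤ Real.exp (κ * M) * ‖a - b‖ := by
  have hP := hz.isPrimitive.sub hw.isPrimitive
  have hl := v.intervalIntegrable_norm.const_mul κ
  have hbound : ∀ᵐ s, s ∈ Ioo (0 : ℝ) 1 →
      ‖(v s : V) (z s) - (v s : V) (w s)‖ ≤ κ * ‖v s‖ * ‖z s - w s‖ :=
    Eventually.of_forall fun s _ => h.norm_apply_sub_le _ _ _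
  have hle := v.integral_const_mul_norm_le h.1.le hv ht
  have h1 := hP.exp_neg_mul_norm_le hl hbound ht
  have h2 := hP.norm_le_exp_mul hl hbound ht
  rw [hz.zero, hw.zero] at h1 h2
  refine ⟨le_trans ?_ h1, h2.trans ?_⟩ <;> gcongr

theorem flowEnd_eq (h : IsAdmissible V κ) {v : Control V} {a : Euc q} {z : ℝ → Euc q}
    (hz : IsForwardSolution v a z) : flowEnd v a = z 1 := by
  have hex : ∃ z : ℝ → Euc q, IsForwardSolution v a z := ⟨z, hz⟩
  rw [flowEnd, dif_pos hex]
  have := (h.norm_forward_sub hex.choose_spec hz le_rfl (t := 1) (by simp)).2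
  rw [sub_self, norm_zero, mul_zero] at this
  exact sub_eq_zero.1 (norm_le_zero_iff.1 this)

theorem norm_forward_sub_le (h : IsAdmissible V κ) {v w : Control V} {a : Euc q}
    {z y : ℝ → Euc q} (hz : IsForwardSolution v a z) (hy : IsForwardSolution w a y) {M : ℝ}
    (hw : ‖w‖ ≤ M) {t : ℝ} (ht : t ∈ Icc (0 : ℝ) 1) :
    ‖y t - z t‖ ≤ Real.exp (κ * M) * (κ * ‖w - v‖) := by
  have hP := hy.isPrimitive.sub hz.isPrimitive
  have h1 := hP.norm_le_exp_mul_integral (by simp [hy.zero, hz.zero])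
    (w.intervalIntegrable_norm.const_mul κ) ((v.intervalIntegrable_norm_sub w).const_mul κ)
    (fun s => mul_nonneg h.1.le (norm_nonneg _)) (fun s => mul_nonneg h.1.le (norm_nonneg _))
    (fun s _ => by
      -- The change of position is absorbed by Grönwall; the change of control is the forcing term.
      have h1 : (w s : V) (y s) - (v s : V) (z s) =
          ((w s : V) (y s) - (w s : V) (z s)) + (w s - v s : V) (z s) := by
        rw [RKHS.coe_sub, Pi.sub_apply]; abel
      rw [h1]
      exact (norm_add_le _ _).trans
        (add_le_add (h.norm_apply_sub_le _ _ _) (h.norm_apply_le _ _))) ht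
  refine h1.trans ?_
  have h2 := w.integral_const_mul_norm_le h.1.le hw (t := 1) (by simp)
  have h3 : ∫ s in (0 : ℝ)..1, κ * ‖w s - v s‖ ≤ κ * ‖w - v‖ := by
    rw [intervalIntegral.integral_const_mul]
    exact mul_le_mul_of_nonneg_left (v.integral_norm_sub_le w) h.1.le
  have h4 : 0 ≤ ∫ s in (0 : ℝ)..1, κ * ‖w s - v s‖ :=
    intervalIntegral.integral_nonneg zero_le_one fun s _ => mul_nonneg h.1.le (norm_nonneg _)
  gcongr

theorem exists_adjointSolution (h : IsAdmissible V κ) (v : Control V) {z : ℝ → Euc q}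
    (hz : Continuous z) (c : Euc q) {M : ℝ} (hv : ‖v‖ ≤ M) :
    ∃ p, IsAdjointSolution v z c p ∧ ∀ t ∈ Icc (0 : ℝ) 1,
      Real.exp (-(κ * M)) * ‖c‖ ≤ ‖p t‖ ∧ ‖p t‖ ≤ Real.exp (κ * M) * ‖c‖ := by
  have hcont : Continuous fun r : V × Euc q =>
      ContinuousLinearMap.adjoint (fderiv ℝ (r.1 : Euc q → Euc q) r.2) :=
    (ContinuousLinearMap.adjoint (𝕜 := ℝ) (E := Euc q) (F := Euc q)).continuous.comp
      h.continuous_fderiv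
  have hpair : AEStronglyMeasurable (fun s => ((v s : V), z s)) (volume.restrict (Icc (0 : ℝ) 1)) :=
    (Lp.aestronglyMeasurable v).prodMk hz.aestronglyMeasurable
  have hm := hcont.comp_aestronglyMeasurable hpair
  obtain ⟨p, hp, hp1, hpp, hpb⟩ := exists_linear_backward_solution
    (D := fun s => ContinuousLinearMap.adjoint (fderiv ℝ (v s : Euc q → Euc q) (z s)))
    (l := fun s => κ * ‖v s‖) hm
    (fun s => (LinearIsometryEquiv.norm_map _ _).trans_le (h.norm_fderiv_le _ _))
    (v.intervalIntegrable_norm.const_mul κ) c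
  refine ⟨p, ⟨hp, hp1, hpp⟩, fun t ht => ?_⟩
  have hle := v.integral_const_mul_norm_le h.1.le hv (t := 1) (by simp)
  obtain ⟨h1, h2⟩ := hpb t ht
  refine ⟨le_trans ?_ h1, h2.trans ?_⟩ <;> gcongr

theorem intervalIntegrable_inner_apply (h : IsAdmissible V κ) {z p : ℝ → Euc q}
    (hz : Continuous z) (hp : Continuous p) (v w : Control V) :
    IntervalIntegrable (fun s => inner ℝ (p s) ((w s - v s : V) (z s))) volume 0 1 := by
  rw [intervalIntegrable_unit_iff]
  obtain ⟨C, hC⟩ := isCompact_Icc.exists_bound_of_continuousOn (s := Icc (0 : ℝ) 1)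
    hp.continuousOn
  refine Integrable.mono' (((w.integrable.sub v.integrable).norm.const_mul κ).const_mul C)
    (hp.aestronglyMeasurable.inner (h.continuous_apply.comp_aestronglyMeasurable
      ((w.integrable.sub v.integrable).1.prodMk hz.aestronglyMeasurable))) ?_
  refine (ae_restrict_iff' measurableSet_Icc).2 (Eventually.of_forall fun s hs => ?_)
  have hC0 : 0 ≤ C := (norm_nonneg _).trans (hC s hs)
  refine (norm_inner_le_norm _ _).trans ?_
  exact mul_le_mul (hC s hs) (h.norm_apply_le _ _) (norm_nonneg _) hC0

/-- The derivative of `⟨c, z_1⟩` in the direction `w - v`, up to a quadratic error. -/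
theorem abs_inner_forward_sub_sub_integral_le (h : IsAdmissible V κ) {v w : Control V}
    {a c : Euc q} {z y p : ℝ → Euc q} {M : ℝ} (hv : ‖v‖ ≤ M) (hw : ‖w‖ ≤ M)
    (hzc : Continuous z) (hz : IsForwardSolution v a z) (hy : IsForwardSolution w a y)
    (hp : IsAdjointSolution v z c p)
    (hpb : ∀ t ∈ Icc (0 : ℝ) 1, ‖p t‖ ≤ Real.exp (κ * M) * ‖c‖) :
    |inner ℝ c (y 1 - z 1) - ∫ s in (0 : ℝ)..1, inner ℝ (p s) ((w s - v s : V) (z s))| ≤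
      Real.exp (κ * M) * ‖c‖ * (κ * M * (Real.exp (κ * M) * κ) ^ 2 +
        κ * (Real.exp (κ * M) * κ)) * ‖w - v‖ ^ 2 := by
  have hκ := h.1.le
  have hM : 0 ≤ M := (norm_nonneg v).trans hv
  -- `D` is the Lipschitz constant of the trajectory with respect to the control.
  set D := Real.exp (κ * M) * κ with hD
  have hD0 : 0 ≤ D := mul_nonneg (Real.exp_pos _).le hκ
  -- The pairing `⟨p, y - z⟩` vanishes at time `0` and equals `⟨c, y_1 - z_1⟩` at time `1`.
  have hP := hp.2.2.real_inner (hy.isPrimitive.sub hz.isPrimitive)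
  have h1 := hP.2 1 (by simp)
  simp only [hy.zero, hz.zero, sub_self, inner_zero_right, zero_add, hp.2.1] at h1
  have hm := h.intervalIntegrable_inner_apply hzc hp.1 v w
  rw [h1, ← intervalIntegral.integral_sub hP.1 hm, ← Real.norm_eq_abs]
  have hbi : IntervalIntegrable (fun s => Real.exp (κ * M) * ‖c‖ *
      (κ * ‖v s‖ * (D * ‖w - v‖) ^ 2 + κ * ‖w s - v s‖ * (D * ‖w - v‖))) volume 0 1 :=
    (((v.intervalIntegrable_norm.const_mul κ).mul_const _).add
      (((v.intervalIntegrable_norm_sub w).const_mul κ).mul_const _)).const_mul _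
  refine (intervalIntegral.norm_integral_le_of_norm_le zero_le_one
    (Eventually.of_forall fun s hs => ?_) hbi).trans ?_
  · have hs : s ∈ Icc (0 : ℝ) 1 := Ioc_subset_Icc_self hs
    have hyz : ‖y s - z s‖ ≤ D * ‖w - v‖ := by
      rw [hD, mul_assoc]
      exact h.norm_forward_sub_le hz hy hw hs
    -- The adjoint equation cancels the term linear in `y - z`. What remains is a Taylor remainder
    -- of `v_s` and the increment of `w_s - v_s` between two nearby points, both of second order in
    -- `‖w - v‖` after integration.
    have h2 : inner ℝ (p s) ((w s : V) (y s) - (v s : V) (z s)) +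
        inner ℝ (-ContinuousLinearMap.adjoint (fderiv ℝ (v s : Euc q → Euc q) (z s)) (p s))
          (y s - z s) - inner ℝ (p s) ((w s - v s : V) (z s)) =
        inner ℝ (p s) (((v s : V) (y s) - (v s : V) (z s) -
          fderiv ℝ (v s : Euc q → Euc q) (z s) (y s - z s)) +
          ((w s - v s : V) (y s) - (w s - v s : V) (z s))) := by
      rw [inner_neg_left, ContinuousLinearMap.adjoint_inner_left, ← sub_eq_add_neg,
        ← inner_sub_right, ← inner_sub_right]
      congr 1
      simp only [RKHS.coe_sub, Pi.sub_apply]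
      abel
    rw [h2]
    refine (norm_inner_le_norm _ _).trans ?_
    have h3 := h.norm_apply_sub_sub_fderiv_le (v s) (z s) (y s)
    have h4 := h.norm_apply_sub_le (w s - v s) (y s) (z s)
    refine mul_le_mul (hpb s hs) ((norm_add_le _ _).trans (add_le_add (h3.trans ?_)
      (h4.trans ?_))) (norm_nonneg _) (by positivity) <;> gcongr
  · rw [intervalIntegral.integral_const_mul, intervalIntegral.integral_add
      ((v.intervalIntegrable_norm.const_mul κ).mul_const _)
      (((v.intervalIntegrable_norm_sub w).const_mul κ).mul_const _),
      intervalIntegral.integral_mul_const, intervalIntegral.integral_mul_const,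
      intervalIntegral.integral_const_mul, intervalIntegral.integral_const_mul, mul_assoc]
    have h5 := v.integral_norm_le.trans hv
    have h6 := v.integral_norm_sub_le w
    have h7 : κ * (∫ s in (0 : ℝ)..1, ‖v s‖) * (D * ‖w - v‖) ^ 2 +
        κ * (∫ s in (0 : ℝ)..1, ‖w s - v s‖) * (D * ‖w - v‖) ≤
        κ * M * (D * ‖w - v‖) ^ 2 + κ * ‖w - v‖ * (D * ‖w - v‖) := by
      gcongr
    have h8 := mul_le_mul_of_nonneg_left h7
      (mul_nonneg (Real.exp_pos (κ * M)).le (norm_nonneg c))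
    refine (le_of_eq (by ring)).trans (h8.trans (le_of_eq ?_))
    ring

theorem norm_flowEnd_sub_le (h : IsAdmissible V κ) {v w : Control V} {M : ℝ} (hw : ‖w‖ ≤ M)
    (a : Euc q) : ‖flowEnd w a - flowEnd v a‖ ≤ Real.exp (κ * M) * κ * ‖w - v‖ := by
  obtain ⟨z, -, hz⟩ := h.exists_forwardSolution v a
  obtain ⟨y, -, hy⟩ := h.exists_forwardSolution w a
  rw [h.flowEnd_eq hz, h.flowEnd_eq hy, mul_assoc]
  exact h.norm_forward_sub_le hz hy hw (by simp)

end IsAdmissible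

end Flow

/-! ### Singular values and extreme eigenvalues -/

section SingularValues

variable {E F : Type*} [NormedAddCommGroup E] [InnerProductSpace ℝ E] [FiniteDimensional ℝ E]
  [NormedAddCommGroup F] [InnerProductSpace ℝ F] [FiniteDimensional ℝ F]

/-- Diagonalization of `T* T`. As singular values are listed in decreasing order, comparing each
with the first or the last gives both operator bounds. -/
theorem LinearMap.norm_apply_sq_eq_sum_singularValues (T : E →ₗ[ℝ] F) {n : ℕ}
    (hn : Module.finrank ℝ E = n) (x : E) : ‖T x‖ ^ 2 = ∑ i : Fin n, T.singularValues i ^ 2 *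
      ((T.isSymmetric_adjoint_comp_self.eigenvectorBasis hn).repr x i) ^ 2 := by
  set b := T.isSymmetric_adjoint_comp_self.eigenvectorBasis hn with hb
  have h1 : ‖T x‖ ^ 2 = inner ℝ x ((LinearMap.adjoint T ∘ₗ T) x) := by
    rw [← real_inner_self_eq_norm_sq, LinearMap.comp_apply, LinearMap.adjoint_inner_right]
  rw [h1, ← b.repr.inner_map_map, PiLp.inner_apply]
  refine Finset.sum_congr rfl fun i _ => ?_
  rw [hb, T.isSymmetric_adjoint_comp_self.eigenvectorBasis_apply_self_apply hn x i,
    T.sq_singularValues_fin hn i]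
  simp only [RCLike.ofReal_real_eq_id, id_eq, RCLike.inner_apply, conj_trivial]
  ring

end SingularValues

theorem sum_repr_sq {n : ℕ} {E : Type*} [NormedAddCommGroup E] [InnerProductSpace ℝ E]
    (b : OrthonormalBasis (Fin n) ℝ E) (x : E) : ∑ i, (b.repr x i) ^ 2 = ‖x‖ ^ 2 := by
  rw [← b.repr.norm_map x, EuclideanSpace.real_norm_sq_eq]

theorem norm_toEuclideanLin_le {m n : ℕ} (M : Matrix (Fin m) (Fin n) ℝ) (x : Euc n) :
    ‖Matrix.toEuclideanLin M x‖ ≤ sigmaMax M * ‖x‖ := by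
  set T := Matrix.toEuclideanLin M with hT
  have h0 : 0 ≤ sigmaMax M := T.singularValues_nonneg 0
  refine le_of_sq_le_sq ?_ (by positivity)
  rw [T.norm_apply_sq_eq_sum_singularValues finrank_euclideanSpace_fin, mul_pow,
    ← sum_repr_sq (T.isSymmetric_adjoint_comp_self.eigenvectorBasis finrank_euclideanSpace_fin) x,
    Finset.mul_sum]
  refine Finset.sum_le_sum fun i _ => ?_
  gcongr
  · exact T.singularValues_nonneg _
  · exact T.singularValues_antitone (Nat.zero_le _)

theorem sigmaMin_mul_norm_le {m n : ℕ} (M : Matrix (Fin m) (Fin n) ℝ) (x : Euc n) :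
    sigmaMin M * ‖x‖ ≤ ‖Matrix.toEuclideanLin M x‖ := by
  set T := Matrix.toEuclideanLin M with hT
  have h0 : 0 ≤ sigmaMin M := T.singularValues_nonneg _
  refine le_of_sq_le_sq ?_ (norm_nonneg _)
  rw [T.norm_apply_sq_eq_sum_singularValues finrank_euclideanSpace_fin, mul_pow,
    ← sum_repr_sq (T.isSymmetric_adjoint_comp_self.eigenvectorBasis finrank_euclideanSpace_fin) x,
    Finset.mul_sum]
  refine Finset.sum_le_sum fun i _ => ?_
  gcongr
  -- An index `i < n` satisfies `i ≤ n - 1`; for `n = 0` there is no index, so truncated subtraction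
  -- is harmless.
  exact T.singularValues_antitone (by have := i.2; omega)

section Eigenvalues

variable {ι : Type*} [Fintype ι] [DecidableEq ι] {M : Matrix ι ι ℝ}

/-- Subtracting the least eigenvalue shifts the spectrum into `[0, ∞)`, so the difference is
positive semidefinite. -/
theorem lambdaMin_mul_sum_sq_le (hM : M.IsHermitian) (p : ι → ℝ) :
    lambdaMin M * ∑ i, p i ^ 2 ≤ p ⬝ᵥ (M.mulVec p) := by
  have hpos : (M - algebraMap ℝ (Matrix ι ι ℝ) (lambdaMin M)).PosSemidef := by
    rw [Matrix.posSemidef_iff_isHermitian_and_spectrum_nonneg]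
    refine ⟨hM.sub (by simp [Matrix.algebraMap_eq_diagonal]), ?_⟩
    rw [← spectrum.sub_singleton_eq]
    rintro _ ⟨a, ha, _, rfl, rfl⟩
    exact sub_nonneg.2 (csInf_le Matrix.finite_real_spectrum.bddBelow ha)
  have := hpos.dotProduct_mulVec_nonneg p
  simp only [star_trivial, Matrix.sub_mulVec, dotProduct_sub, Algebra.algebraMap_eq_smul_one,
    Matrix.smul_mulVec, Matrix.one_mulVec, dotProduct_smul, smul_eq_mul] at this
  simp only [dotProduct, ← pow_two] at this ⊢
  linarith

theorem dotProduct_mulVec_le_lambdaMax_mul (hM : M.IsHermitian) (p : ι → ℝ) :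
    p ⬝ᵥ (M.mulVec p) ≤ lambdaMax M * ∑ i, p i ^ 2 := by
  have hpos : (algebraMap ℝ (Matrix ι ι ℝ) (lambdaMax M) - M).PosSemidef := by
    rw [Matrix.posSemidef_iff_isHermitian_and_spectrum_nonneg]
    refine ⟨Matrix.IsHermitian.sub
      (by simp [Matrix.algebraMap_eq_diagonal]) hM, ?_⟩
    rw [← spectrum.singleton_sub_eq]
    rintro _ ⟨_, rfl, a, ha, rfl⟩
    exact sub_nonneg.2 (le_csSup Matrix.finite_real_spectrum.bddAbove ha)
  have := hpos.dotProduct_mulVec_nonneg p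
  simp only [star_trivial, Matrix.sub_mulVec, dotProduct_sub, Algebra.algebraMap_eq_smul_one,
    Matrix.smul_mulVec, Matrix.one_mulVec, dotProduct_smul, smul_eq_mul] at this
  simp only [dotProduct, ← pow_two] at this ⊢
  linarith

theorem lambdaMin_nonneg (hM : M.PosSemidef) : 0 ≤ lambdaMin M :=
  Real.sInf_nonneg fun _ ha =>
    (Matrix.posSemidef_iff_isHermitian_and_spectrum_nonneg.1 hM).2 ha

end Eigenvalues

/-! ### The kernel matrix -/

section Kernel

variable {q N : ℕ} (V : Type*) [NormedAddCommGroup V] [InnerProductSpace ℝ V]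
    [CompleteSpace V] [RKHS ℝ V (Euc q) (Euc q)]

theorem kernelMatrix_eq_gram (z : Fin N → Euc q) :
    kernelMatrix V z = Matrix.gram ℝ fun a : Fin N × Fin q =>
      RKHS.kerFun V (z a.1) (EuclideanSpace.single a.2 (1 : ℝ)) := by
  ext a b
  rw [Matrix.gram_apply, RKHS.kerFun_inner, RKHS.kerFun_apply, EuclideanSpace.inner_single_left]
  simp [kernelMatrix]

theorem posSemidef_kernelMatrix (z : Fin N → Euc q) : (kernelMatrix V z).PosSemidef := by
  rw [kernelMatrix_eq_gram]
  exact Matrix.posSemidef_gram ℝ _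

/-- The link between gradient and universality: the `V`-norm of a combination of kernel sections is
the quadratic form of their Gram matrix. -/
theorem norm_sum_kerFun_sq (z p : Fin N → Euc q) :
    ‖∑ i, RKHS.kerFun V (z i) (p i)‖ ^ 2 =
      (fun a : Fin N × Fin q => p a.1 a.2) ⬝ᵥ
        ((kernelMatrix V z).mulVec fun a => p a.1 a.2) := by
  have h1 : ∑ i, RKHS.kerFun V (z i) (p i) = ∑ a : Fin N × Fin q,
      p a.1 a.2 • RKHS.kerFun V (z a.1) (EuclideanSpace.single a.2 (1 : ℝ)) := by
    rw [Fintype.sum_prod_type]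
    refine Finset.sum_congr rfl fun i _ => ?_
    conv_lhs => rw [← (EuclideanSpace.basisFun (Fin q) ℝ).sum_repr (p i)]
    simp
  rw [h1, kernelMatrix_eq_gram, ← real_inner_self_eq_norm_sq, sum_inner]
  refine Finset.sum_congr rfl fun a _ => ?_
  rw [inner_sum, Matrix.mulVec, dotProduct, Finset.mul_sum]
  refine Finset.sum_congr rfl fun b _ => ?_
  rw [Matrix.gram_apply, real_inner_smul_left, real_inner_smul_right]
  ring

theorem sum_prod_sq (p : Fin N → Euc q) :
    ∑ a : Fin N × Fin q, (p a.1 a.2) ^ 2 = ∑ i, ‖p i‖ ^ 2 := by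
  simp_rw [EuclideanSpace.real_norm_sq_eq, Fintype.sum_prod_type]

theorem kernelLower_le_lambdaMin {s : ℝ} {z : Fin N → Euc q}
    (hz : ∀ i j, i ≠ j → s⁻¹ ≤ ‖z i - z j‖) :
    kernelLower V N s ≤ lambdaMin (kernelMatrix V z) :=
  ciInf_le (f := fun z : {z : Fin N → Euc q // ∀ i j, i ≠ j → s⁻¹ ≤ ‖z i - z j‖} =>
    lambdaMin (kernelMatrix V z.1))
    -- Bounding by a real infimum needs a family bounded below; positive semidefiniteness supplies
    -- `0`.
    ⟨0, by rintro _ ⟨z, rfl⟩; exact lambdaMin_nonneg (posSemidef_kernelMatrix V z.1)⟩ ⟨z, hz⟩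

theorem kernelLower_mul_le {s : ℝ} {z : Fin N → Euc q}
    (hz : ∀ i j, i ≠ j → s⁻¹ ≤ ‖z i - z j‖) (p : Fin N → Euc q) :
    kernelLower V N s * ∑ i, ‖p i‖ ^ 2 ≤ ‖∑ i, RKHS.kerFun V (z i) (p i)‖ ^ 2 := by
  rw [norm_sum_kerFun_sq, ← sum_prod_sq]
  refine le_trans ?_ (lambdaMin_mul_sum_sq_le (posSemidef_kernelMatrix V z).isHermitian _)
  gcongr
  exact kernelLower_le_lambdaMin V hz

theorem norm_sum_kerFun_sq_le
    (hb : BddAbove (range fun z : Fin N → Euc q => lambdaMax (kernelMatrix V z)))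
    (z p : Fin N → Euc q) :
    ‖∑ i, RKHS.kerFun V (z i) (p i)‖ ^ 2 ≤ kernelUpper V N * ∑ i, ‖p i‖ ^ 2 := by
  rw [norm_sum_kerFun_sq, ← sum_prod_sq]
  refine (dotProduct_mulVec_le_lambdaMax_mul (posSemidef_kernelMatrix V z).isHermitian _).trans ?_
  gcongr
  exact le_ciSup hb z

theorem kernelUpper_nonneg : 0 ≤ kernelUpper V N :=
  Real.iSup_nonneg fun z => Real.sSup_nonneg fun _ ha =>
    (Matrix.posSemidef_iff_isHermitian_and_spectrum_nonneg.1 (posSemidef_kernelMatrix V z)).2 ha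

theorem kernelLower_eq_of_subsingleton [Subsingleton (Fin N)] (s s' : ℝ) :
    kernelLower V N s = kernelLower V N s' := by
  refine Function.Surjective.iInf_congr
    (fun z => ⟨z.1, fun i j hij => absurd (Subsingleton.elim i j) hij⟩) (fun z => ?_) fun z => rfl
  exact ⟨⟨z.1, fun i j hij => absurd (Subsingleton.elim i j) hij⟩, rfl⟩

variable {V}

/-- The second alternative serves a single data point: there `(dataSep x)⁻¹ = 0`, so the argument is
not positive, but the separation constraint is void and `kernelLower` is constant. -/
theorem IsNUniversal.kernelLower_pos (h : IsNUniversal V N) {s : ℝ}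
    (hs : 0 < s ∨ Subsingleton (Fin N)) : 0 < kernelLower V N s := by
  rcases hs with hs | hs
  · simpa using h.2 s⁻¹ (inv_pos.2 hs)
  · rw [kernelLower_eq_of_subsingleton V s (1 : ℝ)⁻¹]
    exact h.2 1 one_pos

end Kernel

/-! ### Data separation -/

theorem dataSep_le {d N : ℕ} (x : Fin N → Euc d) {i j : Fin N} (hij : i ≠ j) :
    dataSep x ≤ ‖x i - x j‖ :=
  ciInf_le (f := fun p : {p : Fin N × Fin N // p.1 ≠ p.2} => ‖x p.1.1 - x p.1.2‖)
    (Set.finite_range _).bddBelow ⟨(i, j), hij⟩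

theorem dataSep_pos {d N : ℕ} {x : Fin N → Euc d} (hx : Function.Injective x)
    (hN : ¬ Subsingleton (Fin N)) : 0 < dataSep x := by
  obtain ⟨i, j, hij⟩ := not_subsingleton_iff_nontrivial.1 hN
  have : Nonempty {p : Fin N × Fin N // p.1 ≠ p.2} := ⟨⟨(i, j), hij⟩⟩
  obtain ⟨p, hp⟩ := exists_eq_ciInf_of_finite
    (f := fun p : {p : Fin N × Fin N // p.1 ≠ p.2} => ‖x p.1.1 - x p.1.2‖)
  rw [dataSep, ← hp]
  exact norm_pos_iff.2 (sub_ne_zero.2 fun h => p.2 (hx h))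

/-! ### Gradient descent under a local Polyak–Łojasiewicz condition -/

section GradientDescent

variable {E : Type*} [NormedAddCommGroup E] [InnerProductSpace ℝ E]

theorem hasGradientAt_of_quadratic_error [CompleteSpace E] {L : E → ℝ} {v g : E} {C r : ℝ}
    (hr : 0 < r)
    (h : ∀ w, ‖w - v‖ ≤ r → |L w - L v - inner ℝ g (w - v)| ≤ C * ‖w - v‖ ^ 2) :
    HasGradientAt L g v := by
  rw [hasGradientAt_iff_isLittleO]
  have h1 : (fun w => L w - L v - inner ℝ g (w - v)) =O[𝓝 v] fun w => ‖w - v‖ ^ 2 := by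
    refine Asymptotics.IsBigO.of_bound C ?_
    filter_upwards [Metric.closedBall_mem_nhds v hr] with w hw
    rw [Metric.mem_closedBall, dist_eq_norm] at hw
    simpa using h w hw
  refine h1.trans_isLittleO ?_
  have h2 : Tendsto (fun w => w - v) (𝓝 v) (𝓝 0) := by
    simpa using (continuous_id.sub continuous_const).tendsto (x := v) (f := fun w => w - v)
  exact (Asymptotics.isLittleO_norm_pow_id one_lt_two).comp_tendsto h2

/-- Linear convergence of gradient descent, when the Polyak–Łojasiewicz inequality, a gradient
bound and a descent inequality hold on a sufficiently large ball. -/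
theorem gradDescent_converges [CompleteSpace E] {L : E → ℝ} {v₀ : E} {μ R Γ C η : ℝ}
    (hcont : Continuous L)
    (hL : ∀ v, 0 ≤ L v) (hμ : 0 < μ) (hη : 0 < η) (hΓ : 0 ≤ Γ)
    (hημ : η * μ < 1) (hCη : C * η ≤ 1 / 2)
    (hPL : ∀ v, ‖v - v₀‖ ≤ R → 2 * μ * L v ≤ ‖gradient L v‖ ^ 2)
    (hgrad : ∀ v, ‖v - v₀‖ ≤ R → ‖gradient L v‖ ≤ Γ * √(L v))
    (hdesc : ∀ v w, ‖v - v₀‖ ≤ R → ‖w - v₀‖ ≤ R →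
      L w ≤ L v + inner ℝ (gradient L v) (w - v) + C * ‖w - v‖ ^ 2)
    (hRad : 2 * Γ * √(L v₀) / μ ≤ R) :
    (∀ k : ℕ, L (gradDescent L η v₀ k) ≤ (1 - η * μ) ^ k * L v₀) ∧
    (∀ k : ℕ, ‖gradDescent L η v₀ k - v₀‖ ≤ R) ∧
    ∃ vStar, Tendsto (gradDescent L η v₀) atTop (𝓝 vStar) ∧ L vStar = 0 := by
  set v := gradDescent L η v₀ with hv
  set x := η * μ with hx
  have hx0 : 0 < x := mul_pos hη hμ
  -- Since `1 - x ≤ (1 - x/2)²`, the square root of the risk, and hence the step length, decays at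
  -- rate `r`.
  set r := 1 - x / 2 with hr
  have hr0 : 0 < r := by rw [hr]; linarith
  have hr1 : r < 1 := by rw [hr]; linarith
  have hsq : 1 - x ≤ r ^ 2 := by rw [hr]; nlinarith [sq_nonneg x]
  have hstep : ∀ k, v (k + 1) - v k = -(η • gradient L (v k)) := fun k => by
    rw [hv, gradDescent]; abel
  have hlen : ∀ k, ‖v k - v₀‖ ≤ R → L (v k) ≤ (1 - x) ^ k * L v₀ →
      ‖v (k + 1) - v k‖ ≤ η * Γ * √(L v₀) * r ^ k := fun k h1 h2 => by
    rw [hstep, norm_neg, norm_smul, Real.norm_of_nonneg hη.le]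
    have h3 : √(L (v k)) ≤ r ^ k * √(L v₀) := by
      refine Real.sqrt_le_iff.2 ⟨by positivity, h2.trans ?_⟩
      rw [mul_pow, Real.sq_sqrt (hL v₀), ← pow_mul, mul_comm k 2, pow_mul]
      have := hL v₀
      gcongr
    calc η * ‖gradient L (v k)‖ ≤ η * (Γ * (r ^ k * √(L v₀))) := by
          gcongr
          exact (hgrad _ h1).trans (by gcongr)
      _ = _ := by ring
  -- The factor `η` cancels against `1 - r = ημ/2`, so the total length is bounded independently of
  -- the step size.
  have hgeom : ∀ k : ℕ, η * Γ * √(L v₀) * ((1 - r ^ k) / (1 - r)) ≤ R := fun k => by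
    refine le_trans ?_ hRad
    have h1 : 1 - r = η * μ / 2 := by rw [hr]; ring
    rw [h1, show η * Γ * √(L v₀) * ((1 - r ^ k) / (η * μ / 2)) =
      2 * Γ * √(L v₀) / μ * (1 - r ^ k) by field_simp]
    refine mul_le_of_le_one_right (by positivity) ?_
    linarith [pow_pos hr0 k]
  -- Distance and decay are proved together. The length of a step depends only on the current
  -- iterate, so the next iterate is known to lie in the ball before the descent inequality is
  -- applied to it.
  have key : ∀ k : ℕ, ‖v k - v₀‖ ≤ η * Γ * √(L v₀) * ((1 - r ^ k) / (1 - r)) ∧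
      L (v k) ≤ (1 - x) ^ k * L v₀ := by
    intro k
    induction k with
    | zero => simp [hv, gradDescent]
    | succ k ih =>
      have hk := ih.1.trans (hgeom k)
      have h1 : ‖v (k + 1) - v₀‖ ≤ η * Γ * √(L v₀) * ((1 - r ^ (k + 1)) / (1 - r)) := by
        have h2 := norm_add_le (v (k + 1) - v k) (v k - v₀)
        rw [sub_add_sub_cancel] at h2
        refine h2.trans ((add_le_add (hlen k hk ih.2) ih.1).trans (le_of_eq ?_))
        have : 1 - r ≠ 0 := by linarith
        field_simp
        ring
      refine ⟨h1, ?_⟩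
      have h3 := hdesc _ _ hk (h1.trans (hgeom _))
      rw [hstep, inner_neg_right, real_inner_smul_right, real_inner_self_eq_norm_sq, norm_neg,
        norm_smul, Real.norm_of_nonneg hη.le, mul_pow] at h3
      have h4 := hPL _ hk
      -- The quadratic error uses up at most half of the decrease `η ‖∇L‖²`; the remaining half is
      -- at least `ημ L` by the Polyak–Łojasiewicz inequality.
      have h5 : C * (η ^ 2 * ‖gradient L (v k)‖ ^ 2) ≤ η / 2 * ‖gradient L (v k)‖ ^ 2 := by
        have := mul_le_mul_of_nonneg_right hCη
          (mul_nonneg hη.le (sq_nonneg ‖gradient L (v k)‖))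
        linarith
      have h6 := mul_le_mul_of_nonneg_left h4 (half_pos hη).le
      calc L (v (k + 1)) ≤ (1 - x) * L (v k) := by rw [hx]; linarith
        _ ≤ (1 - x) * ((1 - x) ^ k * L v₀) :=
            mul_le_mul_of_nonneg_left ih.2 (by linarith)
        _ = _ := by ring
  have hball : ∀ k, ‖v k - v₀‖ ≤ R := fun k => (key k).1.trans (hgeom k)
  refine ⟨fun k => (key k).2, hball, ?_⟩
  have hcauchy : CauchySeq v := cauchySeq_of_le_geometric r (η * Γ * √(L v₀)) hr1 fun k => by
    rw [dist_eq_norm, norm_sub_rev]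
    exact hlen k (hball k) (key k).2
  obtain ⟨vStar, hvStar⟩ := cauchySeq_tendsto_of_complete hcauchy
  refine ⟨vStar, hvStar, ?_⟩
  have h1 : Tendsto (fun k => L (v k)) atTop (𝓝 (L vStar)) := (hcont.tendsto vStar).comp hvStar
  have h2 : Tendsto (fun k : ℕ => (1 - x) ^ k * L v₀) atTop (𝓝 (0 * L v₀)) :=
    (tendsto_pow_atTop_nhds_zero_of_lt_one (by linarith) (by linarith)).mul_const _
  rw [zero_mul] at h2
  exact le_antisymm (le_of_tendsto_of_tendsto' h1 h2 fun k => (key k).2) (hL _)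

end GradientDescent

/-! ### The gradient of the empirical risk -/

theorem inner_toEuclideanLin_transpose {m n : ℕ} (B : Matrix (Fin m) (Fin n) ℝ) (r : Euc m)
    (e : Euc n) : inner ℝ (Matrix.toEuclideanLin B.transpose r) e =
      inner ℝ r (Matrix.toEuclideanLin B e) := by
  rw [← Matrix.conjTranspose_eq_transpose_of_trivial,
    Matrix.toEuclideanLin_conjTranspose_eq_adjoint, LinearMap.adjoint_inner_left]

section Risk

variable {d d' q N : ℕ} {V : Type*} [NormedAddCommGroup V] [InnerProductSpace ℝ V]
  [RKHS ℝ V (Euc q) (Euc q)] {κ : ℝ}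

theorem risk_nonneg (A : Matrix (Fin q) (Fin d) ℝ) (B : Matrix (Fin d') (Fin q) ℝ)
    (x : Fin N → Euc d) (y : Fin N → Euc d') (v : Control V) : 0 ≤ risk A B x y v := by
  unfold risk; positivity

theorem sum_norm_sq_eq_risk (hN : 1 ≤ N) (A : Matrix (Fin q) (Fin d) ℝ)
    (B : Matrix (Fin d') (Fin q) ℝ) (x : Fin N → Euc d) (y : Fin N → Euc d') (v : Control V) :
    ∑ i, ‖resNet A B v (x i) - y i‖ ^ 2 = 2 * N * risk A B x y v := by
  have : (N : ℝ) ≠ 0 := by positivity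
  unfold risk
  field_simp

theorem IsAdmissible.norm_resNet_sub_le (h : IsAdmissible V κ) (A : Matrix (Fin q) (Fin d) ℝ)
    (B : Matrix (Fin d') (Fin q) ℝ) {v w : Control V} {M : ℝ} (hw : ‖w‖ ≤ M) (x : Euc d) :
    ‖resNet A B w x - resNet A B v x‖ ≤
      sigmaMax B * (Real.exp (κ * M) * κ) * ‖w - v‖ := by
  rw [resNet, resNet, ← map_sub, mul_assoc]
  exact (norm_toEuclideanLin_le B _).trans (mul_le_mul_of_nonneg_left
    (h.norm_flowEnd_sub_le hw _) (LinearMap.singularValues_nonneg _ _))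

variable [CompleteSpace V]

/-- On bounded sets the risk agrees with its first-order expansion up to a quadratic error, and
its gradient at `v` is `t ↦ N⁻¹ ∑ᵢ K(·, zⁱ_t) pⁱ_t`, where `zⁱ` is the flow of `v` through the
`i`-th input and `pⁱ` is the solution of the adjoint equation. -/
theorem IsAdmissible.exists_risk_expansion (h : IsAdmissible V κ) (A : Matrix (Fin q) (Fin d) ℝ)
    (B : Matrix (Fin d') (Fin q) ℝ) (x : Fin N → Euc d) (y : Fin N → Euc d') (M : ℝ) :
    ∃ C, 0 ≤ C ∧ ∀ v : Control V, ‖v‖ ≤ M → ∃ (g : Control V) (z p : Fin N → ℝ → Euc q),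
      (∀ w : Control V, ‖w‖ ≤ M →
        |risk A B x y w - risk A B x y v - inner ℝ g (w - v)| ≤ C * ‖w - v‖ ^ 2) ∧
      (∀ i, IsForwardSolution v (Matrix.toEuclideanLin A (x i)) (z i)) ∧
      (∀ i, ∀ t ∈ Icc (0 : ℝ) 1,
        Real.exp (-(κ * ‖v‖)) *
            ‖Matrix.toEuclideanLin B.transpose (resNet A B v (x i) - y i)‖ ≤ ‖p i t‖ ∧
        ‖p i t‖ ≤ Real.exp (κ * ‖v‖) *
            ‖Matrix.toEuclideanLin B.transpose (resNet A B v (x i) - y i)‖) ∧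
      Continuous (fun s => (N : ℝ)⁻¹ • ∑ i, RKHS.kerFun V (z i s) (p i s)) ∧
      ‖g‖ ^ 2 = ∫ s in (0 : ℝ)..1, ‖(N : ℝ)⁻¹ • ∑ i, RKHS.kerFun V (z i s) (p i s)‖ ^ 2 := by
  rcases lt_or_ge M 0 with hM | hM
  · exact ⟨0, le_rfl, fun v hv => absurd ((norm_nonneg v).trans hv) (not_le.2 hM)⟩
  have hκ := h.1.le
  have hσB : 0 ≤ sigmaMax B := LinearMap.singularValues_nonneg _ _
  have hσBt : 0 ≤ sigmaMax B.transpose := LinearMap.singularValues_nonneg _ _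
  set D : ℝ := Real.exp (κ * M) * κ with hD
  have hD0 : 0 ≤ D := mul_nonneg (Real.exp_pos _).le hκ
  -- `ρ i` bounds the residual uniformly for `‖v‖ ≤ M`: its value at the zero control plus Lipschitz
  -- growth.
  set ρ : Fin N → ℝ := fun i => ‖resNet A B (0 : Control V) (x i) - y i‖ + sigmaMax B * D * M
    with hρ
  have hρ0 : ∀ i, 0 ≤ ρ i := fun i => by positivity
  set K : ℝ := κ * M * D ^ 2 + κ * D with hK
  have hK0 : 0 ≤ K := by positivity
  refine ⟨(N : ℝ)⁻¹ * ∑ i, (Real.exp (κ * M) * (sigmaMax B.transpose * ρ i) * K +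
    1 / 2 * (sigmaMax B * D) ^ 2), by positivity, fun v hv => ?_⟩
  set r : Fin N → Euc d' := fun i => resNet A B v (x i) - y i with hr
  set c : Fin N → Euc q := fun i => Matrix.toEuclideanLin B.transpose (r i) with hc
  have hcρ : ∀ i, ‖c i‖ ≤ sigmaMax B.transpose * ρ i := fun i => by
    refine (norm_toEuclideanLin_le _ _).trans (mul_le_mul_of_nonneg_left ?_ hσBt)
    have h1 : r i = (resNet A B (0 : Control V) (x i) - y i) +
        (resNet A B v (x i) - resNet A B (0 : Control V) (x i)) := by simp only [hr]; abel
    rw [h1]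
    refine (norm_add_le _ _).trans (add_le_add le_rfl ?_)
    refine (h.norm_resNet_sub_le A B hv (x i)).trans ?_
    rw [sub_zero]
    gcongr
  choose z hzc hz using fun i => h.exists_forwardSolution v (Matrix.toEuclideanLin A (x i))
  -- The adjoint bounds carry `‖v‖` instead of `M`, so that enlarging `M` later does not spoil the
  -- exponents in `μ`.
  choose p hp hpb using fun i => h.exists_adjointSolution v (hzc i) (c i) (le_refl ‖v‖)
  have hpM : ∀ i, ∀ t ∈ Icc (0 : ℝ) 1, ‖p i t‖ ≤ Real.exp (κ * M) * ‖c i‖ := fun i t ht =>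
    (hpb i t ht).2.trans (by gcongr)
  have hfc : Continuous (fun s => (N : ℝ)⁻¹ • ∑ i, RKHS.kerFun V (z i s) (p i s)) :=
    (continuous_finsetSum _ fun i _ =>
      (h.continuous_kerFun.comp (hzc i)).clm_apply (hp i).1).const_smul _
  refine ⟨(Control.memLp_of_continuous hfc).toLp, z, p, fun w hw => ?_, hz, hpb, hfc,
    Control.norm_toLp_sq hfc⟩
  set I : Fin N → ℝ := fun i =>
    ∫ s in (0 : ℝ)..1, inner ℝ (p i s) ((w s - v s : V) (z i s)) with hI
  set δ : Fin N → Euc d' := fun i => resNet A B w (x i) - resNet A B v (x i) with hδ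
  have hinner : inner ℝ (Control.memLp_of_continuous hfc).toLp (w - v) = (N : ℝ)⁻¹ * ∑ i, I i := by
    rw [Control.inner_toLp_sub hfc, hI, ← intervalIntegral.integral_finsetSum fun i _ =>
      h.intervalIntegrable_inner_apply (hzc i) (hp i).1 v w,
      ← intervalIntegral.integral_const_mul]
    refine intervalIntegral.integral_congr fun s _ => ?_
    simp only [real_inner_smul_left, sum_inner, RKHS.kerFun_inner]
  -- Expanding the square around the residual `r i`: the pairing with `δ i` is linearized by the
  -- adjoint state, and `‖δ i‖²` is already quadratic.
  have hrisk : risk A B x y w - risk A B x y v =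
      (N : ℝ)⁻¹ * ∑ i, (inner ℝ (r i) (δ i) + 1 / 2 * ‖δ i‖ ^ 2) := by
    rw [risk, risk, ← mul_sub, ← Finset.sum_sub_distrib, one_div, mul_inv, mul_comm (2 : ℝ)⁻¹,
      mul_assoc, Finset.mul_sum]
    congr 1
    refine Finset.sum_congr rfl fun i _ => ?_
    have h1 : resNet A B w (x i) - y i = r i + δ i := by simp only [hr, hδ]; abel
    rw [h1, norm_add_sq_real]
    ring
  rw [hrisk, hinner, ← mul_sub, ← Finset.sum_sub_distrib, abs_mul, abs_of_nonneg (by positivity),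
    mul_assoc, Finset.sum_mul]
  refine mul_le_mul_of_nonneg_left ((Finset.abs_sum_le_sum_abs _ _).trans
    (Finset.sum_le_sum fun i _ => ?_)) (by positivity)
  obtain ⟨u, -, hu⟩ := h.exists_forwardSolution w (Matrix.toEuclideanLin A (x i))
  have h1 := h.abs_inner_forward_sub_sub_integral_le hv hw (hzc i) (hz i) hu (hp i) (hpM i)
  have h2 : inner ℝ (c i) (u 1 - z i 1) = inner ℝ (r i) (δ i) := by
    rw [hc, inner_toEuclideanLin_transpose, hδ]
    simp only [resNet, h.flowEnd_eq (hz i), h.flowEnd_eq hu, map_sub]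
  rw [h2] at h1
  have h3 : ‖δ i‖ ^ 2 ≤ (sigmaMax B * D) ^ 2 * ‖w - v‖ ^ 2 := by
    rw [← mul_pow]
    exact pow_le_pow_left₀ (norm_nonneg _) (h.norm_resNet_sub_le A B hw (x i)) 2
  have h4 : Real.exp (κ * M) * ‖c i‖ * K * ‖w - v‖ ^ 2 ≤
      Real.exp (κ * M) * (sigmaMax B.transpose * ρ i) * K * ‖w - v‖ ^ 2 := by
    gcongr
    exact hcρ i
  calc |inner ℝ (r i) (δ i) + 1 / 2 * ‖δ i‖ ^ 2 - I i|
      = |(inner ℝ (r i) (δ i) - I i) + 1 / 2 * ‖δ i‖ ^ 2| := by ring_nf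
    _ ≤ |inner ℝ (r i) (δ i) - I i| + 1 / 2 * ‖δ i‖ ^ 2 := by
        refine (abs_add_le _ _).trans (add_le_add le_rfl (abs_of_nonneg ?_).le)
        positivity
    _ ≤ Real.exp (κ * M) * (sigmaMax B.transpose * ρ i) * K * ‖w - v‖ ^ 2 +
        1 / 2 * ((sigmaMax B * D) ^ 2 * ‖w - v‖ ^ 2) := by
        gcongr
        exact h1.trans h4
    _ = _ := by ring

theorem IsAdmissible.exists_gradient_expansion (h : IsAdmissible V κ)
    (A : Matrix (Fin q) (Fin d) ℝ) (B : Matrix (Fin d') (Fin q) ℝ) (x : Fin N → Euc d)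
    (y : Fin N → Euc d') (M : ℝ) :
    ∃ C, 0 ≤ C ∧ ∀ v : Control V, ‖v‖ ≤ M → ∃ z p : Fin N → ℝ → Euc q,
      DifferentiableAt ℝ (risk A B x y) v ∧
      (∀ w : Control V, ‖w‖ ≤ M →
        |risk A B x y w - risk A B x y v - inner ℝ (gradient (risk A B x y) v) (w - v)| ≤
          C * ‖w - v‖ ^ 2) ∧
      (∀ i, IsForwardSolution v (Matrix.toEuclideanLin A (x i)) (z i)) ∧
      (∀ i, ∀ t ∈ Icc (0 : ℝ) 1,
        Real.exp (-(κ * ‖v‖)) *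
            ‖Matrix.toEuclideanLin B.transpose (resNet A B v (x i) - y i)‖ ≤ ‖p i t‖ ∧
        ‖p i t‖ ≤ Real.exp (κ * ‖v‖) *
            ‖Matrix.toEuclideanLin B.transpose (resNet A B v (x i) - y i)‖) ∧
      Continuous (fun s => (N : ℝ)⁻¹ • ∑ i, RKHS.kerFun V (z i s) (p i s)) ∧
      ‖gradient (risk A B x y) v‖ ^ 2 =
        ∫ s in (0 : ℝ)..1, ‖(N : ℝ)⁻¹ • ∑ i, RKHS.kerFun V (z i s) (p i s)‖ ^ 2 := by
  -- Radius `M + 1` leaves a unit ball around every `v` with `‖v‖ ≤ M`, which identifies `g` as the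
  -- gradient even on the boundary.
  obtain ⟨C, hC0, hC⟩ := h.exists_risk_expansion (V := V) A B x y (M + 1)
  refine ⟨C, hC0, fun v hv => ?_⟩
  obtain ⟨g, z, p, hg, hz, hp, hc, hn⟩ := hC v (by linarith)
  have hgrad : HasGradientAt (risk A B x y) g v :=
    hasGradientAt_of_quadratic_error one_pos fun w hw => hg w (by
      have := norm_add_le v (w - v)
      rw [add_sub_cancel] at this
      linarith)
  rw [hgrad.gradient]
  exact ⟨z, p, hgrad.differentiableAt, fun w hw => hg w (by linarith), hz, hp, hc, hn⟩

end Risk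

/-! ### The Polyak–Łojasiewicz inequality from universality -/

section Bounds

variable {d d' q N : ℕ} {V : Type*} [NormedAddCommGroup V] [InnerProductSpace ℝ V]
  [CompleteSpace V] [RKHS ℝ V (Euc q) (Euc q)] {κ : ℝ}

/-- The gradient bounds that universality of the kernel provides on the ball of radius `M`. -/
theorem IsAdmissible.gradient_bounds (h : IsAdmissible V κ) (hN : 1 ≤ N)
    (hb : BddAbove (range fun z : Fin N → Euc q => lambdaMax (kernelMatrix V z)))
    {A : Matrix (Fin q) (Fin d) ℝ} {B : Matrix (Fin d') (Fin q) ℝ} (hA : 0 < sigmaMin A)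
    {x : Fin N → Euc d} {y : Fin N → Euc d'} {M : ℝ}
    (hl : 0 < kernelLower V N ((sigmaMin A)⁻¹ * (dataSep x)⁻¹ * Real.exp (κ * M)))
    {v : Control V} (hv : ‖v‖ ≤ M) {z p : Fin N → ℝ → Euc q} {g : Control V}
    (hz : ∀ i, IsForwardSolution v (Matrix.toEuclideanLin A (x i)) (z i))
    (hp : ∀ i, ∀ t ∈ Icc (0 : ℝ) 1,
        Real.exp (-(κ * ‖v‖)) *
            ‖Matrix.toEuclideanLin B.transpose (resNet A B v (x i) - y i)‖ ≤ ‖p i t‖ ∧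
        ‖p i t‖ ≤ Real.exp (κ * ‖v‖) *
            ‖Matrix.toEuclideanLin B.transpose (resNet A B v (x i) - y i)‖)
    (hc : Continuous (fun s => (N : ℝ)⁻¹ • ∑ i, RKHS.kerFun V (z i s) (p i s)))
    (hg : ‖g‖ ^ 2 = ∫ s in (0 : ℝ)..1, ‖(N : ℝ)⁻¹ • ∑ i, RKHS.kerFun V (z i s) (p i s)‖ ^ 2) :
    2 * (1 / (N : ℝ) * sigmaMin B.transpose ^ 2 *
        kernelLower V N ((sigmaMin A)⁻¹ * (dataSep x)⁻¹ * Real.exp (κ * M)) *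
        Real.exp (-2 * κ * M)) * risk A B x y v ≤ ‖g‖ ^ 2 ∧
      ‖g‖ ^ 2 ≤ 2 / N * kernelUpper V N * sigmaMax B.transpose ^ 2 * Real.exp (2 * κ * M) *
        risk A B x y v := by
  have hN0 : (0 : ℝ) < N := by positivity
  have hκ := h.1.le
  set l := kernelLower V N ((sigmaMin A)⁻¹ * (dataSep x)⁻¹ * Real.exp (κ * M)) with hldef
  set r : Fin N → Euc d' := fun i => resNet A B v (x i) - y i with hr
  have hrisk : ∑ i, ‖r i‖ ^ 2 = 2 * N * risk A B x y v := sum_norm_sq_eq_risk hN A B x y v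
  have hσ : 0 ≤ sigmaMin B.transpose := LinearMap.singularValues_nonneg _ _
  have hσ' : 0 ≤ sigmaMax B.transpose := LinearMap.singularValues_nonneg _ _
  have hint : IntervalIntegrable
      (fun s => ‖(N : ℝ)⁻¹ • ∑ i, RKHS.kerFun V (z i s) (p i s)‖ ^ 2) volume 0 1 :=
    (hc.norm.pow 2).intervalIntegrable 0 1
  have hnorm : ∀ s, ‖(N : ℝ)⁻¹ • ∑ i, RKHS.kerFun V (z i s) (p i s)‖ ^ 2 =
      ((N : ℝ)⁻¹) ^ 2 * ‖∑ i, RKHS.kerFun V (z i s) (p i s)‖ ^ 2 := fun s => by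
    rw [norm_smul, mul_pow, Real.norm_of_nonneg (by positivity)]
  have hconst : ∀ a : ℝ, ∫ _ in (0 : ℝ)..1, a = a := fun a => by simp
  rw [hg]
  constructor
  · refine (hconst _).symm.trans_le (intervalIntegral.integral_mono_on zero_le_one (by simp) hint
      fun s hs => ?_)
    -- Inputs are at least `σ_min(A) δ` apart after the lift by `A`, and the flow shrinks distances
    -- at most by `e^{-κM}`; the product is the inverse of the argument of `λ`.
    have hsep : ∀ i j, i ≠ j →
        ((sigmaMin A)⁻¹ * (dataSep x)⁻¹ * Real.exp (κ * M))⁻¹ ≤ ‖z i s - z j s‖ := by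
      intro i j hij
      have h1 := (h.norm_forward_sub (hz i) (hz j) hv hs).1
      rw [← map_sub] at h1
      have h2 := sigmaMin_mul_norm_le A (x i - x j)
      have h3 := dataSep_le x hij
      rw [mul_inv, mul_inv, inv_inv, inv_inv, ← Real.exp_neg]
      refine le_trans ?_ h1
      rw [mul_comm]
      gcongr
      exact le_trans (by gcongr) h2
    have h1 := kernelLower_mul_le V hsep fun i => p i s
    have h2 : Real.exp (-2 * κ * M) * sigmaMin B.transpose ^ 2 * ∑ i, ‖r i‖ ^ 2 ≤
        ∑ i, ‖p i s‖ ^ 2 := by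
      rw [Finset.mul_sum]
      refine Finset.sum_le_sum fun i _ => ?_
      have h3 : Real.exp (-(κ * M)) * (sigmaMin B.transpose * ‖r i‖) ≤ ‖p i s‖ := by
        refine le_trans ?_ (hp i s hs).1
        gcongr
        exact sigmaMin_mul_norm_le _ _
      have h4 := pow_le_pow_left₀ (by positivity) h3 2
      refine le_trans (le_of_eq ?_) h4
      rw [mul_pow, mul_pow, ← Real.exp_nat_mul, ← mul_assoc]
      push_cast
      ring_nf
    rw [hnorm]
    calc 2 * (1 / (N : ℝ) * sigmaMin B.transpose ^ 2 * l * Real.exp (-2 * κ * M)) *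
          risk A B x y v
        = ((N : ℝ)⁻¹) ^ 2 * (l * (Real.exp (-2 * κ * M) * sigmaMin B.transpose ^ 2 *
          ∑ i, ‖r i‖ ^ 2)) := by
          rw [hrisk]; field_simp
      _ ≤ ((N : ℝ)⁻¹) ^ 2 * (l * ∑ i, ‖p i s‖ ^ 2) := by gcongr
      _ ≤ _ := by gcongr
  · refine (intervalIntegral.integral_mono_on zero_le_one hint (by simp)
      fun s hs => ?_).trans_eq (hconst _)
    have h1 := norm_sum_kerFun_sq_le V hb (fun i => z i s) fun i => p i s
    have h2 : ∑ i, ‖p i s‖ ^ 2 ≤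
        Real.exp (2 * κ * M) * sigmaMax B.transpose ^ 2 * ∑ i, ‖r i‖ ^ 2 := by
      rw [Finset.mul_sum]
      refine Finset.sum_le_sum fun i _ => ?_
      have h3 : ‖p i s‖ ≤ Real.exp (κ * M) * (sigmaMax B.transpose * ‖r i‖) := by
        refine (hp i s hs).2.trans ?_
        gcongr
        exact norm_toEuclideanLin_le _ _
      have h4 := pow_le_pow_left₀ (norm_nonneg _) h3 2
      refine h4.trans (le_of_eq ?_)
      rw [mul_pow, mul_pow, ← Real.exp_nat_mul, ← mul_assoc]
      push_cast
      ring_nf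
    have hU : 0 ≤ kernelUpper V N := kernelUpper_nonneg V
    rw [hnorm]
    calc ((N : ℝ)⁻¹) ^ 2 * ‖∑ i, RKHS.kerFun V (z i s) (p i s)‖ ^ 2
        ≤ ((N : ℝ)⁻¹) ^ 2 * (kernelUpper V N * ∑ i, ‖p i s‖ ^ 2) := by gcongr
      _ ≤ ((N : ℝ)⁻¹) ^ 2 * (kernelUpper V N * (Real.exp (2 * κ * M) *
          sigmaMax B.transpose ^ 2 * ∑ i, ‖r i‖ ^ 2)) := by gcongr
      _ = _ := by rw [hrisk]; field_simp

end Bounds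

/-! ### Choice of constants and conclusion -/

theorem mainTheorem2 {d d' q N : ℕ} (hN : 1 ≤ N)
    (V : Type*) [NormedAddCommGroup V] [InnerProductSpace ℝ V] [CompleteSpace V]
    [RKHS ℝ V (Euc q) (Euc q)]
    (κ : ℝ) (hadm : IsAdmissible V κ) (huniv : IsNUniversal V N)
    (A : Matrix (Fin q) (Fin d) ℝ) (B : Matrix (Fin d') (Fin q) ℝ)
    (hA : 0 < sigmaMin A) (hB : 0 < sigmaMin B.transpose)
    (x : Fin N → Euc d) (y : Fin N → Euc d') (hx : Function.Injective x)
    (v₀ : Control V) (R₀ R μ : ℝ) (hR₀ : ‖v₀‖ = R₀) (hR : 0 ≤ R)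
    (hinit :
      √8 * sigmaMax B.transpose * √(N * kernelUpper V N * risk A B x y v₀)
          * Real.exp (3 * κ * (R + R₀)) /
        (sigmaMin B.transpose ^ 2 *
          kernelLower V N ((sigmaMin A)⁻¹ * (dataSep x)⁻¹ * Real.exp (κ * (R + R₀)))) ≤ R)
    (hμ : μ = 1 / (N : ℝ) * sigmaMin B.transpose ^ 2 *
      kernelLower V N ((sigmaMin A)⁻¹ * (dataSep x)⁻¹ * Real.exp (κ * (R + R₀))) *
      Real.exp (-2 * κ * (R + R₀))) :
    0 < μ ∧
    Differentiable ℝ (risk (V := V) A B x y) ∧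
    ∃ η₀ : ℝ, 0 < η₀ ∧ ∀ η : ℝ, 0 < η → η ≤ η₀ →
      η * μ < 1 ∧
      (∀ k : ℕ, risk A B x y (gradDescent (risk A B x y) η v₀ k) ≤
        (1 - η * μ) ^ k * risk A B x y v₀) ∧
      (∀ k : ℕ, ‖gradDescent (risk A B x y) η v₀ k - v₀‖ ≤ R) ∧
      ∃ vStar : Control V,
        Tendsto (gradDescent (risk A B x y) η v₀) atTop (𝓝 vStar) ∧
        risk A B x y vStar = 0 ∧ ∀ w : Control V, risk A B x y vStar ≤ risk A B x y w := by
  set M := R + R₀ with hM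
  have hN0 : (0 : ℝ) < N := by positivity
  have hl : 0 < kernelLower V N ((sigmaMin A)⁻¹ * (dataSep x)⁻¹ * Real.exp (κ * M)) := by
    refine huniv.kernelLower_pos ?_
    by_cases hs : Subsingleton (Fin N)
    · exact Or.inr hs
    · have := dataSep_pos hx hs
      exact Or.inl (by positivity)
  have hμ0 : 0 < μ := by rw [hμ]; positivity
  have hdiff : Differentiable ℝ (risk (V := V) A B x y) := fun v => by
    obtain ⟨C, -, hC⟩ := hadm.exists_gradient_expansion (V := V) A B x y ‖v‖
    obtain ⟨-, -, hv, -⟩ := hC v le_rfl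
    exact hv
  refine ⟨hμ0, hdiff, ?_⟩
  obtain ⟨C, hC0, hC⟩ := hadm.exists_gradient_expansion (V := V) A B x y M
  have hball : ∀ v : Control V, ‖v - v₀‖ ≤ R → ‖v‖ ≤ M := fun v hv => by
    have := norm_add_le (v - v₀) v₀
    rw [sub_add_cancel, hR₀] at this
    linarith
  set Q : ℝ := 2 / N * kernelUpper V N * sigmaMax B.transpose ^ 2 * Real.exp (2 * κ * M) with hQ
  have hbounds : ∀ v : Control V, ‖v - v₀‖ ≤ R →
      2 * μ * risk A B x y v ≤ ‖gradient (risk A B x y) v‖ ^ 2 ∧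
        ‖gradient (risk A B x y) v‖ ^ 2 ≤ Q * risk A B x y v := fun v hv => by
    obtain ⟨z, p, -, -, hz, hp, hc, hg⟩ := hC v (hball v hv)
    rw [hμ]
    exact hadm.gradient_bounds hN huniv.1 hA hl (hball v hv) hz hp hc hg
  have hσ : 0 ≤ sigmaMax B.transpose := LinearMap.singularValues_nonneg _ _
  have hU : 0 ≤ kernelUpper V N := kernelUpper_nonneg V
  have hrisk := risk_nonneg (V := V) A B x y
  -- This is `hinit` itself: `√8 = 2√2`, while `e^{3κM}` combines `e^{κM}` from `√Q` with `e^{2κM}`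
  -- from `1/μ`.
  have hRad : 2 * √Q * √(risk A B x y v₀) / μ ≤ R := by
    refine le_trans (le_of_eq ?_) hinit
    have hsq : √Q = √2 * √(kernelUpper V N) * sigmaMax B.transpose * Real.exp (κ * M) / √N := by
      rw [hQ, show 2 / (N : ℝ) * kernelUpper V N * sigmaMax B.transpose ^ 2 *
        Real.exp (2 * κ * M) = 2 * kernelUpper V N *
          (sigmaMax B.transpose * Real.exp (κ * M)) ^ 2 / N by
          rw [mul_pow, ← Real.exp_nat_mul]; push_cast; ring_nf,
        Real.sqrt_div (by positivity), Real.sqrt_mul (by positivity), Real.sqrt_mul (by positivity),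
        Real.sqrt_sq (by positivity)]
      ring
    have h8 : √8 = 2 * √2 := by
      rw [show (8 : ℝ) = 2 ^ 2 * 2 by norm_num, Real.sqrt_mul (by positivity),
        Real.sqrt_sq (by positivity)]
    have he3 : Real.exp (3 * κ * M) = Real.exp (κ * M) ^ 3 := by
      rw [← Real.exp_nat_mul]; push_cast; ring_nf
    have he2 : Real.exp (-2 * κ * M) = (Real.exp (κ * M) ^ 2)⁻¹ := by
      rw [← Real.exp_nat_mul, ← Real.exp_neg]; push_cast; ring_nf
    have hNs : (N : ℝ) = √N * √N := (Real.mul_self_sqrt hN0.le).symm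
    have hNs0 : 0 < √(N : ℝ) := Real.sqrt_pos.2 hN0
    have hσ0 : sigmaMin B.transpose ≠ 0 := hB.ne'
    rw [hsq, hμ, h8, he3, he2, Real.sqrt_mul (by positivity), Real.sqrt_mul (by positivity)]
    have hl0 := hl.ne'
    set l := kernelLower V N ((sigmaMin A)⁻¹ * (dataSep x)⁻¹ * Real.exp (κ * M))
    have hE := (Real.exp_pos (κ * M)).ne'
    have hone : 1 / (N : ℝ) = 1 / (√N * √N) := by rw [← hNs]
    rw [hone]
    field_simp
  -- The two bounds give `ημ ≤ 1/2` and `Cη ≤ 1/2`; `C + 1` guards against `C = 0`.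
  refine ⟨min (1 / (2 * μ)) (1 / (2 * (C + 1))), by positivity, fun η hη hη₀ => ?_⟩
  have hημ : η * μ < 1 := by
    have := hη₀.trans (min_le_left _ _)
    rw [le_div_iff₀ (by positivity)] at this
    linarith
  have hCη : C * η ≤ 1 / 2 := by
    have := hη₀.trans (min_le_right _ _)
    rw [le_div_iff₀ (by positivity)] at this
    linarith
  obtain ⟨h1, h2, vStar, h3, h4⟩ := gradDescent_converges (L := risk A B x y) (v₀ := v₀) (R := R)
    (Γ := √Q) (C := C) hdiff.continuous hrisk hμ0 hη (Real.sqrt_nonneg _) hημ hCη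
    (fun v hv => (hbounds v hv).1)
    (fun v hv => by
      rw [← Real.sqrt_mul (by positivity)]
      exact Real.le_sqrt_of_sq_le (hbounds v hv).2)
    (fun v w hv hw => by
      obtain ⟨-, -, -, hexp, -⟩ := hC v (hball v hv)
      have := (le_abs_self _).trans (hexp w (hball w hw))
      linarith) hRad
  exact ⟨hημ, h1, h2, vStar, h3, h4, fun w => h4 ▸ hrisk w⟩
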